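/- **Setting.** For a set $\mathcal Z$ of data points, $G\ge 1$ groups of sizes $n_1,\dots,n_G$ and parameters $\theta\in\mathbb R^d$, let $D=(D_g)_{g\in[G]}$ be a training set in which $D_g$ consists of $n_g$ points of $\mathcal Z$. Two datasets are neighbouring if they agree except for (at most) one point; in $D$ this point may lie in any group $g$, and its replacement lies in the same group. A randomized mechanism $\mathcal M$ is $(\alpha,\varepsilon)$-RDP if $D_\alpha(\mathcal M(D)\|\mathcal M(D'))\le\varepsilon$ for all neighbouring $D,D'$, where $D_\alpha(P\|Q)=\frac1{\alpha-1}\log\mathbb E_{o\sim Q}\big(\frac{P(o)}{Q(o)}\big)^\alpha$ ($=+\infty$ if $P\not\ll Q$). Put $\operatorname{clip}(x;\xi)=x\min(\xi/\|x\|,1)$. The function $\varepsilon_\alpha(\gamma,\kappa)$ is either of the following: (a) for real $\alpha>1$, the smallest $\varepsilon$ (infimum over $\varepsilon>0$) such that the subsampled Gaussian mechanism with sampling rate $\gamma$ and noise multiplier $\kappa$ is $(\alpha,\varepsilon)$-RDP. On a dataset of $n$ vectors in $\mathbb R^{d'}$, this mechanism draws $\lfloor\gamma n\rfloor$ of them uniformly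 without replacement, sums them after clipping to norm $\xi>0$, and adds $\mathcal N(0,\sigma^2 I)$, where $\sigma/\xi=\kappa$; the guarantee has to hold for all $n,d',\xi,\sigma$; (b) for integer $\alpha\ge2$, the closed form $$\varepsilon_\alpha(\gamma,\kappa)=\tfrac1{\alpha-1}\log\Big(1+\gamma^2\tbinom\alpha2\min\big\{4(e^{4/\kappa^2}-1),\,2e^{4/\kappa^2}\big\}+\sum_{j=3}^{\alpha}\gamma^j\tbinom\alpha j\,2e^{(j-1)2j/\kappa^2}\Big).$$ In both cases $\kappa_\alpha(\gamma,\varepsilon)=\min\{\kappa>0:\varepsilon_\alpha(\gamma,\kappa)\le\varepsilon\}$, understood as an infimum, with the value $+\infty$ (clipping threshold $0$) if there is no such $\kappa$. **The ASC algorithm.** The public inputs are $T,M\in\mathbb N$, $k\ge1$, learning rates $\eta,\eta^\ell\in\mathbb R$, noise scales $\sigma,\tau>0$, a loss clipping threshold $\zeta>0$, a loss sampling rate $\gamma^\ell\in[0,1]$, a per-step budget $\varepsilon^s>0$, and a loss $\ell(z,\theta)\in\mathbb R$, measurable in $\theta$ (the gradient counts as $0$ where it does not exist). The initial $\theta_1$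 is fixed or drawn from a distribution that does not depend on the data. Initially $m=\operatorname{round}_M((M/G)_{g\in[G]})$. Here $\operatorname{round}_M$ rounds every entry to the nearest integer (ties to even) and then corrects the sum to $M$ by adding units to uniformly random entries, or removing units from uniformly random nonzero entries, one at a time. For $t=1,\dots,T$: 1. For every $g$, draw a batch $B_g$ of $m_g$ points from $D_g$ uniformly without replacement (all of $D_g$ if $m_g>n_g$), and let $u_g=\sum_{z\in B_g}\operatorname{clip}\big(\nabla_\theta\ell(z,\theta_t);\,\sigma/\kappa_\alpha(m_g/n_g,\varepsilon^s)\big)$. 2. Let $\theta_{t+1}=\theta_t-\frac\eta M\big(\sum_g u_g+\mathcal N(0,\sigma^2I)\big)$. 3. If $t\bmod k=0$: for every $g$, draw a batch $B^\ell_g$ of $\lfloor\gamma^\ell n_g\rfloor$ points from $D_g$ uniformly without replacement, let $L_g=\frac1{|B^\ell_g|}\big(\sum_{z\in B^\ell_g}\operatorname{clip}(\ell(z,\theta_t);\zeta)+\mathcal N(0,\tau^2)\big)$ and $\tilde m_g=m_g\exp(\eta^\ell L_g)$; then replace $m$ by $\operatorname{round}_M(M\tilde m/\|\tilde m\|_1)$.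 All draws are independent; the output is $\theta_{T+1}$. (Divisions by zero, for $M=0$, empty groups or empty batches, are read as $0$.) **Theorem 1.** The ASC algorithm is $(\alpha,\varepsilon)$-Rényi differentially private with $$\varepsilon=T\,\varepsilon^s+\Big\lfloor\frac Tk\Big\rfloor\,\varepsilon_\alpha\big(\gamma^\ell,\tau/\zeta\big),$$ whichever group contains the point in which the two datasets differ. This holds for every real $\alpha>1$ with $\varepsilon_\alpha$ as in (a), and for every integer $\alpha\ge2$ with $\varepsilon_\alpha$ as in (b), where both the algorithm and the bound use the same $\varepsilon_\alpha$. -/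

import Mathlib

open MeasureTheory ProbabilityTheory
open scoped ENNReal

noncomputable section

namespace ASC

/-! ### Rényi differential privacy -/

open scoped Classical in
/-- Rényi divergence of order `α > 1`:
`(α - 1)⁻¹ * log E_{o ∼ Q} (dP/dQ (o)) ^ α`, and `+∞` if `P` is not absolutely continuous
with respect to `Q`. -/
def renyiDiv {O : Type*} [MeasurableSpace O] (α : ℝ) (P Q : Measure O) : EReal :=
  if P ≪ Q then
    (((α - 1)⁻¹ : ℝ) : EReal) * ENNReal.log (∫⁻ o, (P.rnDeriv Q o) ^ α ∂Q)
  else ⊤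

/-- Two datasets, i.e. families of data points with a common index set, are neighbouring in the
replace-one sense if they agree outside of one index. -/
def ReplaceOne {ι Z : Type*} (D D' : ι → Z) : Prop :=
  ∃ i, ∀ j, j ≠ i → D j = D' j

/-- The mechanism `mech` (it maps a dataset to the law of the output) is `(α, ε)`-RDP with respect
to replace-one neighbours. That `mech` is a randomized mechanism, i.e. that all its values are
probability measures, is part of the property. -/
def IsRDP {ι Z O : Type*} [MeasurableSpace O] (α ε : ℝ) (mech : (ι → Z) → Measure O) : Prop :=
  (∀ D, IsProbabilityMeasure (mech D)) ∧
    ∀ D D' : ι → Z, ReplaceOne D D' → renyiDiv α (mech D) (mech D') ≤ (ε : EReal)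

/-! ### Building blocks -/

/-- Draw `i` uniformly from the (nonempty) finite set `s`, then draw from `K i`. -/
def uniformMixture {ι O : Type*} [MeasurableSpace O] (s : Finset ι) (K : ι → Measure O) :
    Measure O :=
  ((s.card : ℝ≥0∞)⁻¹) • ∑ i ∈ s, K i

/-- The batches of size `m` that can be drawn without replacement from `n` points
(if `m > n`, the only possible batch is the whole dataset). -/
def batches (n m : ℕ) : Finset (Finset (Fin n)) :=
  Finset.powersetCard (min m n) Finset.univ

/-- `clip (x; ξ) = x * min (ξ / ‖x‖) 1`. -/
def clip {E : Type*} [NormedAddCommGroup E] [NormedSpace ℝ E] (x : E) (ξ : ℝ) : E :=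
  min (ξ / ‖x‖) 1 • x

/-- The Gaussian law `N(c, s² I)` on a finite-dimensional inner product space. -/
def gaussian {E : Type*} [NormedAddCommGroup E] [InnerProductSpace ℝ E] [FiniteDimensional ℝ E]
    [MeasurableSpace E] [BorelSpace E] (c : E) (s : ℝ) : Measure E :=
  (stdGaussian E).map (fun x => c + s • x)

/-! ### The privacy curve of the subsampled Gaussian mechanism -/

/-- The subsampled Gaussian mechanism with sampling rate `γ`, clipping threshold `ξ` and noise
scale `σ` on datasets of `n` vectors in `ℝ^d`: draw a batch of `⌊γ n⌋` points without
replacement, sum the clipped points, and add Gaussian noise `N(0, σ² I)`. -/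
def subsampledGaussian (d n : ℕ) (γ ξ σ : ℝ) (x : Fin n → EuclideanSpace ℝ (Fin d)) :
    Measure (EuclideanSpace ℝ (Fin d)) :=
  uniformMixture (batches n ⌊γ * n⌋₊) fun B => gaussian (∑ i ∈ B, clip (x i) ξ) σ

/-- `ε_α(γ, κ)`: the smallest `ε` for which the subsampled Gaussian mechanism with sampling
rate `γ` and noise multiplier `σ / ξ = κ` is `(α, ε)`-RDP. As the value is to depend on nothing
but `α`, `γ` and `κ`, the guarantee has to hold for all dimensions, all dataset sizes and all
`σ`, `ξ` of the ratio `κ`. -/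
def epsSG (α γ κ : ℝ) : ℝ :=
  sInf {ε : ℝ | 0 < ε ∧ ∀ (d n : ℕ) (ξ σ : ℝ), 0 < ξ → 0 < σ → σ / ξ = κ →
    IsRDP α ε (subsampledGaussian d n γ ξ σ)}

/-- The closed form of `ε_α(γ, κ)` for integer orders `a ≥ 2`, obtained by inserting the
Gaussian guarantee `ε^Gauss_j(κ) = j / (2 (κ / 2)²) = 2 j / κ²` (and `ε^Gauss_∞ = ∞`) into the
amplification bound for subsampling without replacement. -/
def epsClosed (a : ℕ) (γ κ : ℝ) : ℝ :=
  1 / ((a : ℝ) - 1) * Real.log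
    (1 + γ ^ 2 * (a.choose 2 : ℝ) *
        min (4 * (Real.exp (2 * 2 / κ ^ 2) - 1)) (2 * Real.exp (2 * 2 / κ ^ 2))
      + ∑ j ∈ Finset.Icc 3 a,
        γ ^ j * (a.choose j : ℝ) * (2 * Real.exp (((j : ℝ) - 1) * (2 * j / κ ^ 2))))

/-- `κ(γ, ε)`: the smallest noise multiplier `κ > 0` with `eps γ κ ≤ ε`, for a given privacy
curve `eps`. -/
def noiseMultiplier (eps : ℝ → ℝ → ℝ) (γ ε : ℝ) : ℝ :=
  sInf {κ : ℝ | 0 < κ ∧ eps γ κ ≤ ε}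

/-! ### Rounding the batch sizes -/

/-- Rounding of a nonnegative real to the nearest integer, ties going to the even neighbour. -/
def bankersRound (x : ℝ) : ℕ :=
  if x - ⌊x⌋₊ < 1 / 2 then ⌊x⌋₊
  else if 1 / 2 < x - ⌊x⌋₊ then ⌊x⌋₊ + 1
  else if Even ⌊x⌋₊ then ⌊x⌋₊ else ⌊x⌋₊ + 1

/-- Add `j` units, each to a uniformly random entry. -/
def addUnits {G : ℕ} : ℕ → (Fin G → ℕ) → Measure (Fin G → ℕ)
  | 0, r => Measure.dirac r
  | j + 1, r => uniformMixture Finset.univ fun g =>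
      addUnits j (Function.update r g (r g + 1))

/-- Remove `j` units, each from a uniformly random entry among the nonzero ones. -/
def removeUnits {G : ℕ} : ℕ → (Fin G → ℕ) → Measure (Fin G → ℕ)
  | 0, r => Measure.dirac r
  | j + 1, r => uniformMixture (Finset.univ.filter fun g => r g ≠ 0) fun g =>
      removeUnits j (Function.update r g (r g - 1))

/-- `round_M`: round every entry to the nearest integer; if the sum is not `M`, distribute the
difference at random. -/
def roundTo {G : ℕ} (M : ℕ) (x : Fin G → ℝ) : Measure (Fin G → ℕ) :=
  let r : Fin G → ℕ := fun g => bankersRound (x g)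
  if ∑ g, r g ≤ M then addUnits (M - ∑ g, r g) r else removeUnits (∑ g, r g - M) r

/-! ### The algorithm -/

/-- The public inputs of the algorithm, for `G` groups, data points in `Z` and model parameters
in `ℝ^d`. -/
structure Params (Z : Type*) (G d : ℕ) where
  /-- group sizes `n_g` -/
  n : Fin G → ℕ
  /-- number of iterations -/
  T : ℕ
  /-- model batch size -/
  M : ℕ
  /-- model learning rate -/
  η : ℝ
  /-- model noise scale (standard deviation) -/
  σ : ℝ
  /-- loss sampling rate `γ^ℓ` -/
  γl : ℝ
  /-- loss temperature -/
  ηl : ℝ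
  /-- loss noise scale (standard deviation) -/
  τ : ℝ
  /-- loss clipping threshold -/
  ζ : ℝ
  /-- weight update frequency -/
  k : ℕ
  /-- per-step privacy budget `ε^s` -/
  εs : ℝ
  /-- the loss `ℓ(z, θ)` -/
  loss : Z → EuclideanSpace ℝ (Fin d) → ℝ
  /-- law of the initial model parameters (a Dirac measure if they are deterministic) -/
  θinit : Measure (EuclideanSpace ℝ (Fin d))

variable {Z : Type*} {G d : ℕ}

/-- A training set: for every group `g`, a family of `n_g` points. -/
abbrev Params.Dataset (p : Params Z G d) : Type _ := ((g : Fin G) × Fin (p.n g)) → Z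

/-- A choice of one batch in every group, of sizes `m_g`, drawn independently and without
replacement: the uniform law on this finite set. -/
def Params.groupBatches (p : Params Z G d) (m : Fin G → ℕ) :
    Finset ((g : Fin G) → Finset (Fin (p.n g))) :=
  Fintype.piFinset fun g => batches (p.n g) (m g)

/-- The clipping threshold `σ / κ_α(m_g / n_g, ε^s)` of group `g`; here `eps` is the privacy
curve `(γ, κ) ↦ ε_α(γ, κ)`. If no multiplier meets the budget (`κ_α = +∞`), the threshold
is `0`; if every multiplier does (`m_g = 0`), the batch is empty and nothing is clipped. -/
def Params.threshold (p : Params Z G d) (eps : ℝ → ℝ → ℝ) (m : Fin G → ℕ) (g : Fin G) : ℝ :=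
  p.σ / noiseMultiplier eps ((m g : ℝ) / (p.n g : ℝ)) p.εs

/-- Model update: the law of `θ_{t+1}` given `θ_t = θ` and the batch sizes `m`. -/
def Params.modelUpdate (p : Params Z G d) (eps : ℝ → ℝ → ℝ) (D : p.Dataset)
    (θ : EuclideanSpace ℝ (Fin d)) (m : Fin G → ℕ) : Measure (EuclideanSpace ℝ (Fin d)) :=
  uniformMixture (p.groupBatches m) fun B =>
    (gaussian (∑ g, ∑ i ∈ B g, clip (gradient (p.loss (D ⟨g, i⟩)) θ) (p.threshold eps m g))
      p.σ).map fun y => θ - (p.η / p.M) • y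

/-- The joint law of the noisy average group losses `(L_g)_g` at the parameters `θ`, on batches
of `⌊γ^ℓ n_g⌋` points. -/
def Params.lossRelease (p : Params Z G d) (D : p.Dataset) (θ : EuclideanSpace ℝ (Fin d)) :
    Measure (Fin G → ℝ) :=
  uniformMixture (p.groupBatches fun g => ⌊p.γl * p.n g⌋₊) fun B =>
    Measure.pi fun g =>
      (gaussian (∑ i ∈ B g, clip (p.loss (D ⟨g, i⟩) θ) p.ζ) p.τ).map
        fun y => 1 / ((B g).card : ℝ) * y

/-- Batch-size update: the law of the new batch sizes given `θ_t = θ` and the old ones `m`, namely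
`round_M (M m̃ / ‖m̃‖₁)` with `m̃_g = m_g exp(η^ℓ L_g)`. -/
def Params.batchSizeUpdate (p : Params Z G d) (D : p.Dataset) (θ : EuclideanSpace ℝ (Fin d))
    (m : Fin G → ℕ) : Measure (Fin G → ℕ) :=
  (p.lossRelease D θ).bind fun L =>
    roundTo p.M fun g =>
      p.M * (m g * Real.exp (p.ηl * L g)) / ∑ h, |m h * Real.exp (p.ηl * L h)|

/-- One iteration `t`: the law of the parameters and batch sizes after it. The batch sizes change
only if `t mod k = 0`; their update uses the parameters `θ_t` from before the model update. -/
def Params.step (p : Params Z G d) (eps : ℝ → ℝ → ℝ) (D : p.Dataset) (t : ℕ)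
    (s : EuclideanSpace ℝ (Fin d) × (Fin G → ℕ)) :
    Measure (EuclideanSpace ℝ (Fin d) × (Fin G → ℕ)) :=
  (p.modelUpdate eps D s.1 s.2).prod
    (if t % p.k = 0 then p.batchSizeUpdate D s.1 s.2 else Measure.dirac s.2)

/-- The law of the parameters and batch sizes after the iterations `1, …, t`. -/
def Params.run (p : Params Z G d) (eps : ℝ → ℝ → ℝ) (D : p.Dataset) :
    ℕ → Measure (EuclideanSpace ℝ (Fin d) × (Fin G → ℕ))
  | 0 => p.θinit.prod (roundTo p.M fun _ => (p.M : ℝ) / G)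
  | t + 1 => (p.run eps D t).bind (p.step eps D (t + 1))

/-- The algorithm: the law of the trained model `θ_{T+1}` as a function of the training set. -/
def Params.asc (p : Params Z G d) (eps : ℝ → ℝ → ℝ) (D : p.Dataset) :
    Measure (EuclideanSpace ℝ (Fin d)) :=
  (p.run eps D p.T).map Prod.fst

end ASC

end

/-! The algorithm is an adaptive composition of private releases followed by post-processing, so the
work lies in one iteration. Divergence bounds are carried in the dual form `RenyiDom`: E_P(g^s) ≤ C
(E_Q g)^s for every test function g ≥ 0, with s = (α-1)/α. In this form composition
(`RenyiDom.bind`, `RenyiDom.prod`) is iterated integration with the constants multiplied,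
post-processing is a change of variables, and mixing over a common random choice
(`RenyiDom.uniformMixture`) is Jensen for the concave map x ↦ x^s. No density of a composed law is
ever needed. `renyiDom_of_renyiDiv_le` and `renyiDiv_le_of_renyiDom` translate to and from the
divergence.

The differing point lies in a single group g. Once the batches of the other groups are fixed, their
contribution is common to both datasets, and what remains is a subsampled Gaussian mechanism on
group g. In the model update, `renyiDom_noiseMultiplier` bounds its cost by ε^s: the threshold is
chosen for the rate m_g/n_g, and a limit argument covers an infimum that is not attained. In the
loss release the cost is ε_α(γ^ℓ, τ/ζ), and the new batch sizes are post-processing of that release.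
The batch sizes belong to the state, so the thresholds of the next iteration are the same functions
of the state for both datasets. Summing over t counts the multiples of k up to T.

Both choices of ε_α enter only through `IsPrivacyCurve`. For the exact curve this is nearly its
definition. For the closed form it is amplification by subsampling without replacement
(`renyiDom_subsampled_gaussian`): P^a/Q^(a-1) is expanded binomially around Q, and each moment
|P-Q|^j/Q^(j-1) is reduced to three single Gaussians by a swap coupling and convexity, which yields
the factor γ^j. -/

namespace ASC

/-! ### Rényi divergence in dual form -/

section RenyiDom

variable {X O O' ι : Type*} [MeasurableSpace X] [MeasurableSpace O] [MeasurableSpace O']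

/-- The dual form of a bound on the Rényi divergence of `P` from `Q`: for all measurable `g ≥ 0`,
`E_P (g ^ s) ≤ C * (E_Q g) ^ s`. For `s = (α - 1) / α` and `C = exp (s ε)`, this is equivalent to
`D_α(P ‖ Q) ≤ ε`. -/
def RenyiDom (s : ℝ) (C : ℝ≥0∞) (P Q : Measure O) : Prop :=
  ∀ g : O → ℝ≥0∞, Measurable g → ∫⁻ o, g o ^ s ∂P ≤ C * (∫⁻ o, g o ∂Q) ^ s

lemma RenyiDom.mono {s : ℝ} {C C' : ℝ≥0∞} {P Q : Measure O} (h : RenyiDom s C P Q)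
    (hC : C ≤ C') : RenyiDom s C' P Q :=
  fun g hg => (h g hg).trans (by gcongr)

lemma RenyiDom.map {s : ℝ} {C : ℝ≥0∞} {P Q : Measure O} (h : RenyiDom s C P Q) {f : O → O'}
    (hf : Measurable f) : RenyiDom s C (P.map f) (Q.map f) := by
  intro g hg
  rw [lintegral_map (hg.pow_const _) hf, lintegral_map hg hf]
  exact h _ (hg.comp hf)

lemma RenyiDom.refl {s : ℝ} (hs0 : 0 < s) (hs1 : s < 1) (P : Measure O)
    [IsProbabilityMeasure P] : RenyiDom s 1 P P := by
  intro g hg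
  have h := ENNReal.lintegral_mul_le_Lp_mul_Lq P
    (Real.HolderConjugate.inv_one_sub_inv hs0 hs1) (f := fun o => g o ^ s) (g := fun _ => 1)
    (hg.pow_const _).aemeasurable aemeasurable_const
  simpa [← ENNReal.rpow_mul, mul_inv_cancel₀ hs0.ne'] using h

/-- Adaptive composition: the bound for the second stage is used pointwise in x, then the bound for
the first stage is applied to the test function x ↦ E_{K' x} g. -/
lemma RenyiDom.bind {s : ℝ} {C C' : ℝ≥0∞} {P Q : Measure X}
    (h : RenyiDom s C P Q) {K K' : X → Measure O} (hK : Measurable K) (hK' : Measurable K')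
    (hKK' : ∀ x, RenyiDom s C' (K x) (K' x)) :
    RenyiDom s (C * C') (P.bind K) (Q.bind K') := by
  intro g hg
  rw [Measure.lintegral_bind hK.aemeasurable (hg.pow_const _).aemeasurable,
    Measure.lintegral_bind hK'.aemeasurable hg.aemeasurable]
  have hm : Measurable fun x => ∫⁻ o, g o ∂(K' x) := (Measure.measurable_lintegral hg).comp hK'
  calc ∫⁻ x, ∫⁻ o, g o ^ s ∂(K x) ∂P ≤ ∫⁻ x, C' * (∫⁻ o, g o ∂(K' x)) ^ s ∂P :=
        lintegral_mono fun x => hKK' x g hg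
    _ = C' * ∫⁻ x, (∫⁻ o, g o ∂(K' x)) ^ s ∂P := lintegral_const_mul _ (hm.pow_const _)
    _ ≤ C' * (C * (∫⁻ x, ∫⁻ o, g o ∂(K' x) ∂Q) ^ s) := by gcongr; exact h _ hm
    _ = _ := by ring

lemma RenyiDom.prod {s : ℝ} {C C' : ℝ≥0∞} {P Q : Measure O} {P' Q' : Measure O'}
    [SFinite P'] [SFinite Q'] (h : RenyiDom s C P Q) (h' : RenyiDom s C' P' Q') :
    RenyiDom s (C * C') (P.prod P') (Q.prod Q') := by
  intro g hg
  rw [lintegral_prod _ (hg.pow_const _).aemeasurable, lintegral_prod _ hg.aemeasurable]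
  have hm : Measurable fun x => ∫⁻ y, g (x, y) ∂Q' := hg.lintegral_prod_right'
  calc ∫⁻ x, ∫⁻ y, g (x, y) ^ s ∂P' ∂P ≤ ∫⁻ x, C' * (∫⁻ y, g (x, y) ∂Q') ^ s ∂P :=
        lintegral_mono fun x => h' _ (hg.comp measurable_prodMk_left)
    _ = C' * ∫⁻ x, (∫⁻ y, g (x, y) ∂Q') ^ s ∂P := lintegral_const_mul _ (hm.pow_const _)
    _ ≤ C' * (C * (∫⁻ x, ∫⁻ y, g (x, y) ∂Q' ∂Q) ^ s) := by gcongr; exact h _ hm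
    _ = _ := by ring

lemma lintegral_uniformMixture (t : Finset ι) (K : ι → Measure O) (g : O → ℝ≥0∞) :
    ∫⁻ o, g o ∂(uniformMixture t K) = (t.card : ℝ≥0∞)⁻¹ * ∑ i ∈ t, ∫⁻ o, g o ∂(K i) := by
  rw [uniformMixture, lintegral_smul_measure, lintegral_finsetSum_measure, smul_eq_mul]

lemma isProbabilityMeasure_uniformMixture {t : Finset ι} (ht : t.Nonempty) {K : ι → Measure O}
    (hK : ∀ i ∈ t, IsProbabilityMeasure (K i)) : IsProbabilityMeasure (uniformMixture t K) := by
  constructor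
  rw [← lintegral_one, lintegral_uniformMixture]
  have : ∀ i ∈ t, ∫⁻ _, (1 : ℝ≥0∞) ∂(K i) = 1 := fun i hi => by
    have := hK i hi
    simp
  rw [Finset.sum_congr rfl this, Finset.sum_const, nsmul_one]
  exact ENNReal.inv_mul_cancel (by simpa using ht.ne_empty) (by simp)

lemma map_uniformMixture (t : Finset ι) (K : ι → Measure O) {f : O → O'} (hf : Measurable f) :
    (uniformMixture t K).map f = uniformMixture t fun i => (K i).map f := by
  refine Measure.ext_of_lintegral _ fun g hg => ?_
  rw [lintegral_map hg hf, lintegral_uniformMixture, lintegral_uniformMixture]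
  simp_rw [lintegral_map hg hf]

lemma uniformMixture_congr {t : Finset ι} {K K' : ι → Measure O} (h : ∀ i ∈ t, K i = K' i) :
    uniformMixture t K = uniformMixture t K' := by
  rw [uniformMixture, uniformMixture, Finset.sum_congr rfl h]

lemma measurable_uniformMixture (t : Finset ι) {K : X → ι → Measure O}
    (hK : ∀ i, Measurable fun x => K x i) : Measurable fun x => uniformMixture t (K x) := by
  refine Measure.measurable_of_measurable_coe _ fun A hA => ?_
  simp only [uniformMixture, Measure.smul_apply, Measure.finsetSum_apply, smul_eq_mul]
  exact (Finset.measurable_sum _ fun i _ => (Measure.measurable_coe hA).comp (hK i)).const_mul _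

/-- Quasi-convexity of the divergence: since s < 1, the average of the (E_{K' i} g)^s is at most the
s-th power of the average, so a common random choice costs nothing. -/
lemma RenyiDom.uniformMixture {s : ℝ} (hs0 : 0 < s) (hs1 : s < 1) {C : ℝ≥0∞} {t : Finset ι}
    (ht : t.Nonempty) {K K' : ι → Measure O} (h : ∀ i ∈ t, RenyiDom s C (K i) (K' i)) :
    RenyiDom s C (uniformMixture t K) (uniformMixture t K') := by
  intro g hg
  rw [lintegral_uniformMixture, lintegral_uniformMixture]
  have hw : ∑ _i ∈ t, (t.card : ℝ≥0∞)⁻¹ = 1 := by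
    rw [Finset.sum_const, nsmul_eq_mul]
    exact ENNReal.mul_inv_cancel (by simpa using ht.ne_empty) (by simp)
  have hJ := ENNReal.rpow_arith_mean_le_arith_mean_rpow t (fun _ => (t.card : ℝ≥0∞)⁻¹)
    (fun i => (∫⁻ o, g o ∂(K' i)) ^ s) hw (p := s⁻¹) (one_le_inv₀ hs0 |>.2 hs1.le)
  calc (t.card : ℝ≥0∞)⁻¹ * ∑ i ∈ t, ∫⁻ o, g o ^ s ∂(K i)
      ≤ (t.card : ℝ≥0∞)⁻¹ * ∑ i ∈ t, C * (∫⁻ o, g o ∂(K' i)) ^ s := by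
        gcongr with i hi
        exact h i hi g hg
    _ = C * ∑ i ∈ t, (t.card : ℝ≥0∞)⁻¹ * (∫⁻ o, g o ∂(K' i)) ^ s := by
        rw [← Finset.mul_sum, ← Finset.mul_sum]; ring
    _ = C * ((∑ i ∈ t, (t.card : ℝ≥0∞)⁻¹ * (∫⁻ o, g o ∂(K' i)) ^ s) ^ s⁻¹) ^ s := by
        rw [← ENNReal.rpow_mul, inv_mul_cancel₀ hs0.ne', ENNReal.rpow_one]
    _ ≤ C * ((t.card : ℝ≥0∞)⁻¹ * ∑ i ∈ t, ∫⁻ o, g o ∂(K' i)) ^ s := by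
        rw [Finset.mul_sum]
        refine mul_le_mul_right (ENNReal.rpow_le_rpow (hJ.trans_eq ?_) hs0.le) _
        simp_rw [← ENNReal.rpow_mul, mul_inv_cancel₀ hs0.ne', ENNReal.rpow_one]

/-- Serves a privacy level defined as an infimum that need not be attained: the constant is
continuous in ε. -/
lemma RenyiDom.of_forall_gt {s : ℝ} {ε : ℝ} {P Q : Measure O}
    (h : ∀ ε' > ε, RenyiDom s (ENNReal.ofReal (Real.exp (s * ε'))) P Q) :
    RenyiDom s (ENNReal.ofReal (Real.exp (s * ε))) P Q := by
  intro g hg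
  have hc : Filter.Tendsto (fun ε' : ℝ => ENNReal.ofReal (Real.exp (s * ε')) *
      (∫⁻ o, g o ∂Q) ^ s) (nhdsWithin ε (Set.Ioi ε))
      (nhds (ENNReal.ofReal (Real.exp (s * ε)) * (∫⁻ o, g o ∂Q) ^ s)) := by
    refine ENNReal.Tendsto.mul_const ?_ (Or.inl (by simp [Real.exp_pos]))
    have : Continuous fun ε' : ℝ => ENNReal.ofReal (Real.exp (s * ε')) :=
      ENNReal.continuous_ofReal.comp (by fun_prop)
    exact this.continuousWithinAt
  exact ge_of_tendsto hc (by filter_upwards [self_mem_nhdsWithin] with ε' hε' using h ε' hε' g hg)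

/-- Monotone convergence along min(g, n). Bounded test functions are the ones for which Gaussian
integrals are continuous in the centre. -/
lemma RenyiDom.of_bounded {s : ℝ} (hs : 0 < s) {C : ℝ≥0∞} {P Q : Measure O}
    (h : ∀ g : O → ℝ≥0∞, Measurable g → (∃ M : ℝ≥0∞, M ≠ ∞ ∧ ∀ o, g o ≤ M) →
      ∫⁻ o, g o ^ s ∂P ≤ C * (∫⁻ o, g o ∂Q) ^ s) : RenyiDom s C P Q := by
  intro g hg
  have hsup : ∀ o, g o ^ s = ⨆ n : ℕ, (min (g o) n) ^ s := fun o => by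
    have h1 : Monotone fun x : ℝ≥0∞ => x ^ s := ENNReal.monotone_rpow_of_nonneg hs.le
    have h2 : g o = ⨆ n : ℕ, min (g o) n := by
      rw [← inf_iSup_eq, ENNReal.iSup_natCast, inf_top_eq]
    conv_lhs => rw [h2]
    exact (ENNReal.orderIsoRpow s hs).map_iSup _
  simp_rw [hsup]
  rw [lintegral_iSup (fun n => (hg.min measurable_const).pow_const s)]
  · refine iSup_le fun n => (h _ (hg.min measurable_const)
      ⟨n, by simp, fun o => min_le_right _ _⟩).trans ?_
    gcongr
    exact min_le_left _ _
  · intro n m hnm o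
    dsimp only
    gcongr

/-- Hölder with exponents 1/s and 1/(1-s) = α, applied to the splitting p g^s = (q g)^s · (p
q^(-s)); the second factor has α-th power p^α q^(1-α). -/
lemma RenyiDom.of_density {α : ℝ} (hα : 1 < α) {μ : Measure O} {p q : O → ℝ≥0∞}
    (hp : Measurable p) (hq : Measurable q) (hq0 : ∀ o, q o ≠ 0) (hqt : ∀ o, q o ≠ ∞) {K : ℝ≥0∞}
    (hK : ∫⁻ o, p o ^ α * q o ^ (1 - α) ∂μ ≤ K) :
    RenyiDom ((α - 1) / α) (K ^ (1 / α)) (μ.withDensity p) (μ.withDensity q) := by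
  have hα0 : 0 < α := by linarith
  set s := (α - 1) / α with hs
  have hs0 : 0 < s := div_pos (by linarith) hα0
  have hs1 : s < 1 := by rw [hs, div_lt_one hα0]; linarith
  have hsα : 1 - s = α⁻¹ := by rw [hs]; field_simp; ring
  intro g hg
  rw [lintegral_withDensity_eq_lintegral_mul _ hp (hg.pow_const _),
    lintegral_withDensity_eq_lintegral_mul _ hq hg]
  have hH := ENNReal.lintegral_mul_le_Lp_mul_Lq μ
    (Real.HolderConjugate.inv_one_sub_inv hs0 hs1) (f := fun o => (q o * g o) ^ s)
    (g := fun o => p o * q o ^ (-s))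
    ((hq.mul hg).pow_const _).aemeasurable (hp.mul (hq.pow_const _)).aemeasurable
  calc ∫⁻ o, (p * fun o => g o ^ s) o ∂μ
      = ∫⁻ o, ((fun o => (q o * g o) ^ s) * fun o => p o * q o ^ (-s)) o ∂μ := by
        refine lintegral_congr fun o => ?_
        simp only [Pi.mul_apply]
        rw [ENNReal.mul_rpow_of_nonneg _ _ hs0.le]
        have : q o ^ s * q o ^ (-s) = 1 := by
          rw [← ENNReal.rpow_add _ _ (hq0 o) (hqt o)]; simp
        calc p o * g o ^ s = p o * g o ^ s * (q o ^ s * q o ^ (-s)) := by rw [this, mul_one]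
          _ = _ := by ring
    _ ≤ _ := hH
    _ ≤ (∫⁻ o, q o * g o ∂μ) ^ s * K ^ (1 / α) := by
        gcongr ?_ * ?_
        · simp_rw [← ENNReal.rpow_mul, mul_inv_cancel₀ hs0.ne', ENNReal.rpow_one]
          simp
        · rw [hsα, inv_inv]
          gcongr
          refine (lintegral_congr fun o => ?_).trans_le hK
          rw [ENNReal.mul_rpow_of_nonneg _ _ hα0.le, ← ENNReal.rpow_mul]
          congr 2
          rw [hs]; field_simp; ring
    _ = _ := by rw [mul_comm]; rfl

lemma renyiDiv_le_iff {α : ℝ} (hα : 1 < α) {ε : ℝ} {P Q : Measure O} :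
    renyiDiv α P Q ≤ ε ↔
      P ≪ Q ∧ ∫⁻ o, P.rnDeriv Q o ^ α ∂Q ≤ ENNReal.ofReal (Real.exp ((α - 1) * ε)) := by
  have h1 : 0 < α - 1 := by linarith
  unfold renyiDiv
  split_ifs with h
  · simp only [h, true_and]
    rw [← ENNReal.log_le_log_iff, ENNReal.log_ofReal_of_pos (Real.exp_pos _), Real.log_exp,
      mul_comm (α - 1), EReal.coe_mul, EReal.coe_inv, ← EReal.div_eq_inv_mul,
      EReal.div_le_iff_le_mul (by exact_mod_cast h1) (EReal.coe_ne_top _), mul_comm]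
  · simp [h]

lemma renyiDom_of_renyiDiv_le {α : ℝ} (hα : 1 < α) {ε : ℝ} {P Q : Measure O}
    [IsProbabilityMeasure P] [IsProbabilityMeasure Q] (h : renyiDiv α P Q ≤ ε) :
    RenyiDom ((α - 1) / α) (ENNReal.ofReal (Real.exp ((α - 1) / α * ε))) P Q := by
  obtain ⟨hac, hI⟩ := (renyiDiv_le_iff hα).1 h
  have := RenyiDom.of_density hα (Measure.measurable_rnDeriv P Q) (q := 1) measurable_const
    (by simp) (by simp) (μ := Q) (K := ENNReal.ofReal (Real.exp ((α - 1) * ε))) (by simpa using hI)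
  rw [Measure.withDensity_rnDeriv_eq _ _ hac, withDensity_one,
    ENNReal.ofReal_rpow_of_pos (Real.exp_pos _), ← Real.exp_mul] at this
  convert this using 3
  ring

/-- The extremal test function is r^α with r = dP/dQ. Truncating r at n makes the integral I finite,
and testing gives I ≤ C I^s; dividing by I^s leaves I^(1/α) ≤ C, and n → ∞ by monotone convergence.
Indicators of Q-null sets give absolute continuity. -/
lemma renyiDiv_le_of_renyiDom {α : ℝ} (hα : 1 < α) {ε : ℝ} {P Q : Measure O}
    [IsProbabilityMeasure P] [IsProbabilityMeasure Q]
    (h : RenyiDom ((α - 1) / α) (ENNReal.ofReal (Real.exp ((α - 1) / α * ε))) P Q) :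
    renyiDiv α P Q ≤ ε := by
  have hα0 : 0 < α := by linarith
  have hα1 : 0 < α - 1 := by linarith
  have hs0 : 0 < (α - 1) / α := div_pos hα1 hα0
  have hac : P ≪ Q := by
    refine Measure.AbsolutelyContinuous.mk fun A hA hQA => ?_
    have := h (A.indicator 1) (measurable_one.indicator hA)
    rw [lintegral_indicator_one hA, hQA, ENNReal.zero_rpow_of_pos hs0, mul_zero] at this
    rw [← lintegral_indicator_one hA]
    refine le_antisymm ((lintegral_mono fun o => ?_).trans this) zero_le
    by_cases ho : o ∈ A <;> simp [ho]
  refine (renyiDiv_le_iff hα).2 ⟨hac, ?_⟩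
  set r := P.rnDeriv Q
  have hr : Measurable r := Measure.measurable_rnDeriv P Q
  have hPr : P = Q.withDensity r := (Measure.withDensity_rnDeriv_eq _ _ hac).symm
  have hn : ∀ n : ℕ, ∫⁻ o, min (r o) n ^ α ∂Q ≤ ENNReal.ofReal (Real.exp ((α - 1) * ε)) := by
    intro n
    have hmn : Measurable fun o => min (r o) n := hr.min measurable_const
    set I := ∫⁻ o, min (r o) n ^ α ∂Q with hI
    have hIt : I ≠ ∞ := by
      refine ne_top_of_le_ne_top (b := (n : ℝ≥0∞) ^ α) (by simp [hα0.le]) ?_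
      calc I ≤ ∫⁻ _, (n : ℝ≥0∞) ^ α ∂Q := lintegral_mono fun o => by
            dsimp only; gcongr; exact min_le_right _ _
        _ = _ := by simp
    have h1 := h _ (hmn.pow_const α)
    have h2 : I ≤ ∫⁻ o, (min (r o) n ^ α) ^ ((α - 1) / α) ∂P := by
      rw [hPr, lintegral_withDensity_eq_lintegral_mul _ hr ((hmn.pow_const _).pow_const _)]
      refine lintegral_mono fun o => ?_
      simp only [Pi.mul_apply]
      rw [← ENNReal.rpow_mul, mul_div_cancel₀ _ hα0.ne']
      calc min (r o) n ^ α = min (r o) n ^ (1 + (α - 1)) := by congr 1; ring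
        _ = min (r o) n * min (r o) n ^ (α - 1) := by
            rw [ENNReal.rpow_add_of_nonneg _ _ zero_le_one hα1.le, ENNReal.rpow_one]
        _ ≤ _ := by gcongr; exact min_le_left _ _
    have h3 := h2.trans h1
    rw [← hI] at h3
    by_cases hI0 : I = 0
    · rw [hI0]; exact zero_le
    have h4 : I ^ (1 / α) ≤ ENNReal.ofReal (Real.exp ((α - 1) / α * ε)) := by
      have h5 : I = I ^ (1 / α) * I ^ ((α - 1) / α) := by
        rw [← ENNReal.rpow_add _ _ hI0 hIt, ← add_div]
        simp [hα0.ne']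
      conv_lhs at h3 => rw [h5]
      rwa [ENNReal.mul_le_mul_iff_left] at h3
      · simp [hI0, hIt]
      · simp [hI0, hIt]
    calc I = (I ^ (1 / α)) ^ α := by rw [← ENNReal.rpow_mul, one_div_mul_cancel hα0.ne',
            ENNReal.rpow_one]
      _ ≤ ENNReal.ofReal (Real.exp ((α - 1) / α * ε)) ^ α := by gcongr
      _ = _ := by
        rw [ENNReal.ofReal_rpow_of_pos (Real.exp_pos _), ← Real.exp_mul]
        congr 2
        field_simp
  have hsup : ∀ o, r o ^ α = ⨆ n : ℕ, (min (r o) n) ^ α := fun o => by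
    have h2 : r o = ⨆ n : ℕ, min (r o) n := by
      rw [← inf_iSup_eq, ENNReal.iSup_natCast, inf_top_eq]
    conv_lhs => rw [h2]
    exact (ENNReal.orderIsoRpow α hα0).map_iSup _
  simp_rw [hsup]
  rw [lintegral_iSup (fun n => (hr.min measurable_const).pow_const α)]
  · exact iSup_le hn
  · intro n m hnm o
    dsimp only
    gcongr

end RenyiDom

/-! ### Gaussian densities, their Rényi moments, and continuity in the centre -/

section Gaussian

variable {E : Type*} [NormedAddCommGroup E] [InnerProductSpace ℝ E]

/-- The density of `N(c, I)` with respect to `N(0, I)`. -/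
noncomputable def gaussianDensity (c y : E) : ℝ := Real.exp (inner ℝ c y - ‖c‖ ^ 2 / 2)

lemma gaussianDensity_pos (c y : E) : 0 < gaussianDensity c y := Real.exp_pos _

/-- Completing the square: the Rényi integrand of two shifted Gaussians is a constant times the
density of a third one, so its integral is read off from total mass 1. -/
lemma gaussianDensity_rpow_mul_rpow (α : ℝ) (c c' y : E) :
    gaussianDensity c y ^ α * gaussianDensity c' y ^ (1 - α) =
      Real.exp (α * (α - 1) / 2 * ‖c - c'‖ ^ 2) * gaussianDensity (c' + α • (c - c')) y := by
  unfold gaussianDensity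
  rw [← Real.exp_mul, ← Real.exp_mul, ← Real.exp_add, ← Real.exp_add]
  congr 1
  simp only [← real_inner_self_eq_norm_sq, inner_add_left, inner_sub_left, inner_smul_left,
    inner_add_right, inner_sub_right, inner_smul_right, RCLike.conj_to_real,
    real_inner_comm c c']
  ring

variable [FiniteDimensional ℝ E] [MeasurableSpace E] [BorelSpace E]

@[fun_prop]
lemma measurable_gaussianDensity (c : E) : Measurable (gaussianDensity c) := by
  unfold gaussianDensity
  fun_prop

lemma integrable_gaussianDensity (c : E) : Integrable (gaussianDensity c) (stdGaussian E) := by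
  have h : Integrable (fun x : ℝ => Real.exp (1 * x)) ((stdGaussian E).map (innerSL ℝ c)) := by
    rw [IsGaussian.map_eq_gaussianReal]
    exact integrable_exp_mul_gaussianReal 1
  rw [integrable_map_measure (by fun_prop) (by fun_prop)] at h
  have h2 := h.mul_const (Real.exp (-(‖c‖ ^ 2 / 2)))
  convert h2 using 2 with y
  simp [gaussianDensity, sub_eq_add_neg, Real.exp_add]

/-- In orthonormal coordinates the integral factors into complex moment generating functions
exp(z²/2) of N(0, 1), with real part from c and imaginary part from t. -/
lemma integral_cexp_stdGaussian (c t : E) :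
    ∫ y, Complex.exp (inner ℝ c y + inner ℝ y t * Complex.I) ∂(stdGaussian E) =
      Complex.exp ((‖c‖ ^ 2 - ‖t‖ ^ 2) / 2 + inner ℝ c t * Complex.I) := by
  set b := stdOrthonormalBasis ℝ E
  set z : Fin (Module.finrank ℝ E) → ℂ := fun i => inner ℝ c (b i) + inner ℝ (b i) t * Complex.I
  rw [stdGaussian_eq_map_pi_orthonormalBasis b, integral_map (Measurable.aemeasurable (by fun_prop))
    (Measurable.aestronglyMeasurable (by fun_prop))]
  have h1 : ∀ x : Fin (Module.finrank ℝ E) → ℝ,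
      Complex.exp (inner ℝ c (∑ i, x i • b i) + inner ℝ (∑ i, x i • b i) t * Complex.I) =
        ∏ i, Complex.exp (z i * x i) := fun x => by
    rw [← Complex.exp_sum, inner_sum, sum_inner]
    congr 1
    push_cast
    rw [Finset.sum_mul, ← Finset.sum_add_distrib]
    refine Finset.sum_congr rfl fun i _ => ?_
    rw [real_inner_smul_left, real_inner_smul_right]
    push_cast [z]
    ring
  simp_rw [h1]
  rw [integral_fintype_prod_eq_prod (f := fun i x => Complex.exp (z i * (x : ℝ)))]
  have h2 : ∀ i, ∫ x : ℝ, Complex.exp (z i * x) ∂(gaussianReal 0 1) =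
      Complex.exp (z i ^ 2 / 2) := fun i => by
    have := complexMGF_id_gaussianReal (μ := 0) (v := 1) (z i)
    simpa [complexMGF] using this
  simp_rw [h2]
  rw [← Complex.exp_sum, ← Finset.sum_div]
  congr 1
  have h3 : ∑ i, z i ^ 2 =
      ((∑ i, inner ℝ c (b i) ^ 2 : ℝ) : ℂ) - ((∑ i, inner ℝ (b i) t ^ 2 : ℝ) : ℂ)
        + 2 * ((∑ i, inner ℝ c (b i) * inner ℝ (b i) t : ℝ) : ℂ) * Complex.I := by
    push_cast
    rw [Finset.mul_sum, Finset.sum_mul, ← Finset.sum_sub_distrib, ← Finset.sum_add_distrib]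
    refine Finset.sum_congr rfl fun i _ => ?_
    simp only [z]
    linear_combination (inner ℝ (b i) t : ℂ) ^ 2 * Complex.I_sq
  rw [h3, b.sum_inner_mul_inner, b.sum_sq_inner_right, b.sum_sq_inner_left]
  push_cast
  ring

/-- Both sides are finite measures with the same characteristic function. -/
lemma gaussian_one_eq_withDensity (c : E) :
    gaussian c 1 = (stdGaussian E).withDensity fun y => ENNReal.ofReal (gaussianDensity c y) := by
  have hfin : IsFiniteMeasure
      ((stdGaussian E).withDensity fun y => ENNReal.ofReal (gaussianDensity c y)) :=
    isFiniteMeasure_withDensity_ofReal (integrable_gaussianDensity c).2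
  have hfin' : IsFiniteMeasure (gaussian c 1) := by unfold gaussian; infer_instance
  refine Measure.ext_of_charFun ?_
  ext t
  rw [charFun_apply, charFun_apply, gaussian,
    integral_map (Measurable.aemeasurable (by fun_prop))
      (Measurable.aestronglyMeasurable (by fun_prop)),
    integral_withDensity_eq_integral_toReal_smul (by fun_prop) (by simp)]
  have h1 : ∀ y : E, (ENNReal.ofReal (gaussianDensity c y)).toReal •
      Complex.exp (inner ℝ y t * Complex.I) =
        Complex.exp (-(‖c‖ ^ 2 / 2)) * Complex.exp (inner ℝ c y + inner ℝ y t * Complex.I) := by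
    intro y
    rw [ENNReal.toReal_ofReal (gaussianDensity_pos c y).le, gaussianDensity, Complex.real_smul]
    push_cast
    rw [← Complex.exp_add, ← Complex.exp_add]
    congr 1
    ring
  have h2 : ∀ y : E, Complex.exp (inner ℝ (c + (1 : ℝ) • y) t * Complex.I) =
      Complex.exp (inner ℝ c t * Complex.I) * Complex.exp (inner ℝ y t * Complex.I) := by
    intro y
    rw [← Complex.exp_add, one_smul, inner_add_left]
    congr 1
    push_cast
    ring
  simp_rw [h1, h2]
  rw [integral_const_mul, integral_const_mul, integral_cexp_stdGaussian, ← charFun_apply,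
    charFun_stdGaussian, ← Complex.exp_add, ← Complex.exp_add]
  congr 1
  ring

instance isProbabilityMeasure_gaussian (c : E) (s : ℝ) : IsProbabilityMeasure (gaussian c s) :=
  Measure.isProbabilityMeasure_map (Measurable.aemeasurable (by fun_prop))

lemma lintegral_gaussian_one (c : E) {h : E → ℝ≥0∞} (hh : Measurable h) :
    ∫⁻ y, h y ∂(gaussian c 1) =
      ∫⁻ y, ENNReal.ofReal (gaussianDensity c y) * h y ∂(stdGaussian E) := by
  rw [gaussian_one_eq_withDensity, lintegral_withDensity_eq_lintegral_mul _ (by fun_prop) hh]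
  rfl

lemma lintegral_gaussianDensity (c : E) :
    ∫⁻ y, ENNReal.ofReal (gaussianDensity c y) ∂(stdGaussian E) = 1 := by
  have := lintegral_gaussian_one c (h := fun _ => 1) measurable_const
  simpa using this.symm

/-- An affine image of a Gaussian law. -/
lemma map_gaussian (c a : E) (s r : ℝ) :
    (gaussian c s).map (fun y => a + r • y) = gaussian (a + r • c) (r * s) := by
  rw [gaussian, Measure.map_map (by fun_prop) (by fun_prop)]
  unfold gaussian
  congr 1
  ext y
  simp [smul_smul, add_assoc]

lemma gaussian_eq_map_gaussian_one (c : E) {s : ℝ} (hs : s ≠ 0) :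
    gaussian c s = (gaussian (s⁻¹ • c) 1).map (fun y => s • y) := by
  have := map_gaussian (s⁻¹ • c) 0 1 s
  simpa [hs, smul_smul] using this.symm

lemma lintegral_gaussianDensity_rpow (α : ℝ) (c c' : E) :
    ∫⁻ y, ENNReal.ofReal (gaussianDensity c y ^ α * gaussianDensity c' y ^ (1 - α))
      ∂(stdGaussian E) = ENNReal.ofReal (Real.exp (α * (α - 1) / 2 * ‖c - c'‖ ^ 2)) := by
  simp_rw [gaussianDensity_rpow_mul_rpow, ENNReal.ofReal_mul (Real.exp_pos _).le]
  rw [lintegral_const_mul _ (by fun_prop), lintegral_gaussianDensity, mul_one]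

/-- The Rényi divergence between two Gaussian laws. -/
lemma renyiDom_gaussian {α : ℝ} (hα : 1 < α) {s : ℝ} (hs : s ≠ 0) (c c' : E) :
    RenyiDom ((α - 1) / α)
      (ENNReal.ofReal (Real.exp ((α - 1) / α * (α * ‖s⁻¹ • (c - c')‖ ^ 2 / 2))))
      (gaussian c s) (gaussian c' s) := by
  rw [gaussian_eq_map_gaussian_one c hs, gaussian_eq_map_gaussian_one c' hs]
  refine RenyiDom.map ?_ (by fun_prop)
  have h := RenyiDom.of_density hα (μ := stdGaussian E)
    (p := fun y => ENNReal.ofReal (gaussianDensity (s⁻¹ • c) y))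
    (q := fun y => ENNReal.ofReal (gaussianDensity (s⁻¹ • c') y))
    (by fun_prop) (by fun_prop) (by simp [gaussianDensity_pos]) (by simp)
    (K := ENNReal.ofReal (Real.exp (α * (α - 1) / 2 * ‖s⁻¹ • (c - c')‖ ^ 2)))
    (by
      rw [smul_sub, ← lintegral_gaussianDensity_rpow]
      refine (lintegral_congr fun y => ?_).le
      rw [ENNReal.ofReal_rpow_of_pos (gaussianDensity_pos _ _),
        ENNReal.ofReal_rpow_of_pos (gaussianDensity_pos _ _), ENNReal.ofReal_mul]
      exact Real.rpow_nonneg (gaussianDensity_pos _ _).le _)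
  rw [← gaussian_one_eq_withDensity, ← gaussian_one_eq_withDensity,
    ENNReal.ofReal_rpow_of_pos (Real.exp_pos _), ← Real.exp_mul] at h
  refine h.mono (le_of_eq ?_)
  congr 2
  have : α ≠ 0 := by linarith
  field_simp

lemma lintegral_gaussian_le_liminf {u : ℕ → E} {c : E}
    (hu : Filter.Tendsto u Filter.atTop (nhds c)) {h : E → ℝ≥0∞} (hh : Measurable h) :
    ∫⁻ y, h y ∂(gaussian c 1) ≤
      Filter.liminf (fun j => ∫⁻ y, h y ∂(gaussian (u j) 1)) Filter.atTop := by
  simp_rw [lintegral_gaussian_one _ hh]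
  refine le_trans (lintegral_mono fun y => ?_)
    (lintegral_liminf_le fun j => (measurable_gaussianDensity (u j)).ennreal_ofReal.mul hh)
  have h1 : Filter.Tendsto (fun j => ENNReal.ofReal (gaussianDensity (u j) y)) Filter.atTop
      (nhds (ENNReal.ofReal (gaussianDensity c y))) := by
    refine (ENNReal.continuous_ofReal.tendsto _).comp ?_
    have : Continuous fun c : E => gaussianDensity c y := by unfold gaussianDensity; fun_prop
    exact (this.tendsto c).comp hu
  exact (ENNReal.Tendsto.mul_const h1
    (Or.inl (by simp [gaussianDensity_pos]))).liminf_eq.ge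

/-- Scheffé's argument: Fatou applied to the densities against h bounds the liminf, and against M -
h bounds the limsup. Hence h may be any bounded measurable function, not only a continuous one. -/
lemma tendsto_lintegral_gaussian {u : ℕ → E} {c : E}
    (hu : Filter.Tendsto u Filter.atTop (nhds c)) {s : ℝ} (hs : s ≠ 0) {h : E → ℝ≥0∞}
    (hh : Measurable h) {M : ℝ≥0∞} (hM : M ≠ ∞) (hhM : ∀ y, h y ≤ M) :
    Filter.Tendsto (fun j => ∫⁻ y, h y ∂(gaussian (u j) s)) Filter.atTop
      (nhds (∫⁻ y, h y ∂(gaussian c s))) := by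
  wlog hs1 : s = 1 generalizing u c h s
  · have hsm : Measurable fun y : E => s • y := by fun_prop
    have := this (hu.const_smul s⁻¹) one_ne_zero (hh.comp hsm) (fun y => hhM _) rfl
    simp_rw [gaussian_eq_map_gaussian_one _ hs, lintegral_map hh hsm]
    exact this
  subst hs1
  have hI : ∀ c : E, ∫⁻ y, h y ∂(gaussian c 1) ≤ M := fun c =>
    (lintegral_mono hhM).trans (by simp)
  have hsub : ∀ c : E, ∫⁻ y, (M - h y) ∂(gaussian c 1) = M - ∫⁻ y, h y ∂(gaussian c 1) :=
    fun c => by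
      rw [lintegral_sub hh ((hI c).trans_lt hM.lt_top).ne (ae_of_all _ hhM)]
      simp
  refine tendsto_of_le_liminf_of_limsup_le (lintegral_gaussian_le_liminf hu hh) ?_
  have h2 := lintegral_gaussian_le_liminf hu (h := fun y => M - h y) (measurable_const.sub hh)
  simp_rw [hsub] at h2
  rw [ENNReal.liminf_const_sub _ _ hM] at h2
  have h3 : Filter.limsup (fun j => ∫⁻ y, h y ∂(gaussian (u j) 1)) Filter.atTop ≤ M :=
    Filter.limsup_le_of_le (h := Filter.Eventually.of_forall fun j => hI _)
  exact (ENNReal.sub_le_sub_iff_left h3 hM).1 h2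

lemma measurable_map_prodMk {X Y : Type*} [MeasurableSpace X] [MeasurableSpace Y] {F : Type*}
    [MeasurableSpace F] (μ : Measure F) [SFinite μ] {f : X → F → Y}
    (hf : Measurable (Function.uncurry f)) : Measurable fun x => μ.map (f x) := by
  refine Measure.measurable_of_measurable_coe _ fun A hA => ?_
  have h1 : ∀ x, μ.map (f x) A = μ (Prod.mk x ⁻¹' (Function.uncurry f ⁻¹' A)) := fun x => by
    have hfx : Measurable (f x) := hf.comp measurable_prodMk_left
    rw [Measure.map_apply hfx hA]
    rfl
  simp_rw [h1]
  exact measurable_measure_prodMk_left (hf hA)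

end Gaussian

/-! ### Ingredients of amplification: binomial expansion, convexity, swap coupling, three-Gaussian
moments -/

section Amplification

/-- Binomial expansion of x^a = (y + (x - y))^a divided by y^(a-1). The terms j = 0, 1 add up to a x
- (a-1) y and are distributed over the two sides so that all terms stay nonnegative and can be
integrated in `ℝ≥0∞`. -/
lemma pow_div_pow_add_le {x y : ℝ} (hy : 0 < y) {a : ℕ} (ha : 2 ≤ a) :
    x ^ a / y ^ (a - 1) + (a - 1) * y ≤
      a * x + ∑ j ∈ Finset.Icc 2 a, (a.choose j : ℝ) * (|x - y| ^ j / y ^ (j - 1)) := by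
  obtain ⟨b, rfl⟩ : ∃ b, a = b + 2 := ⟨a - 2, by omega⟩
  have h1 : x ^ (b + 2) = ∑ j ∈ Finset.range (b + 3),
      (x - y) ^ j * y ^ (b + 2 - j) * ((b + 2).choose j : ℝ) := by
    rw [← add_pow]; ring
  rw [h1, Finset.sum_div]
  have h2 : ∀ j ∈ Finset.range (b + 3),
      (x - y) ^ j * y ^ (b + 2 - j) * ((b + 2).choose j : ℝ) / y ^ (b + 2 - 1) =
        ((b + 2).choose j : ℝ) * ((x - y) ^ j * y / y ^ j) := by
    intro j hj
    have hj' : j ≤ b + 2 := by simpa [Nat.lt_succ_iff] using hj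
    have h3 : y ^ (b + 2 - j) * y ^ j = y ^ (b + 2 - 1) * y := by
      rw [← pow_add, ← pow_succ]; congr 1; omega
    rw [div_eq_iff (by positivity)]
    field_simp
    linear_combination (x - y) ^ j * ((b + 2).choose j : ℝ) * h3
  rw [Finset.sum_congr rfl h2, Finset.range_eq_Ico, Finset.sum_eq_sum_Ico_succ_bot (by omega),
    Finset.sum_eq_sum_Ico_succ_bot (by omega)]
  have h4 : Finset.Ico (0 + 1 + 1) (b + 3) = Finset.Icc 2 (b + 2) := by
    ext; simp; omega
  rw [h4]
  have h5 : ∑ j ∈ Finset.Icc 2 (b + 2), ((b + 2).choose j : ℝ) * ((x - y) ^ j * y / y ^ j) ≤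
      ∑ j ∈ Finset.Icc 2 (b + 2), ((b + 2).choose j : ℝ) * (|x - y| ^ j / y ^ (j - 1)) := by
    refine Finset.sum_le_sum fun j hj => mul_le_mul_of_nonneg_left ?_ (by positivity)
    obtain ⟨i, rfl⟩ : ∃ i, j = i + 1 := ⟨j - 1, by have := Finset.mem_Icc.1 hj; omega⟩
    have h6 : (x - y) ^ (i + 1) * y / y ^ (i + 1) = (x - y) ^ (i + 1) / y ^ i := by
      rw [pow_succ y]; field_simp
    rw [h6, Nat.add_sub_cancel, ← abs_pow]
    gcongr
    exact le_abs_self _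
  have h7 : ((b + 2).choose (0 + 1) : ℝ) * ((x - y) ^ (0 + 1) * y / y ^ (0 + 1)) =
      (b + 2) * (x - y) := by
    simp [hy.ne']
  rw [h7]
  push_cast
  simp only [Nat.choose_zero_right, pow_zero, one_mul, div_one, Nat.cast_one]
  linarith

/-- Joint convexity of (x, y) ↦ |x|^j / y^(j-1): Jensen for the ratios |x_k|/y_k with weights y_k /
Σ y. -/
lemma abs_sum_pow_div_le {κ : Type*} (t : Finset κ) (ht : t.Nonempty) (x y : κ → ℝ)
    (hy : ∀ k ∈ t, 0 < y k) (j : ℕ) (hj : 1 ≤ j) :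
    |∑ k ∈ t, x k| ^ j / (∑ k ∈ t, y k) ^ (j - 1) ≤ ∑ k ∈ t, |x k| ^ j / y k ^ (j - 1) := by
  obtain ⟨i, rfl⟩ : ∃ i, j = i + 1 := ⟨j - 1, by omega⟩
  set Y := ∑ k ∈ t, y k with hY
  have hY0 : 0 < Y := Finset.sum_pos hy ht
  have h := Real.pow_arith_mean_le_arith_mean_pow t (fun k => y k / Y) (fun k => |x k| / y k)
    (fun k hk => (div_pos (hy k hk) hY0).le) (by rw [← Finset.sum_div, ← hY, div_self hY0.ne'])
    (fun k hk => div_nonneg (abs_nonneg _) (hy k hk).le) (i + 1)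
  have e1 : ∑ k ∈ t, y k / Y * (|x k| / y k) = (∑ k ∈ t, |x k|) / Y := by
    rw [Finset.sum_div]
    refine Finset.sum_congr rfl fun k hk => ?_
    have := (hy k hk).ne'
    field_simp
  have e2 : ∑ k ∈ t, y k / Y * (|x k| / y k) ^ (i + 1) =
      (∑ k ∈ t, |x k| ^ (i + 1) / y k ^ i) / Y := by
    rw [Finset.sum_div]
    refine Finset.sum_congr rfl fun k hk => ?_
    have := (hy k hk).ne'
    rw [div_pow, pow_succ (y k)]
    field_simp
  rw [e1, e2, div_pow, le_div_iff₀ hY0] at h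
  rw [Nat.add_sub_cancel]
  refine le_trans ?_ h
  have : (∑ k ∈ t, |x k|) ^ (i + 1) / Y ^ (i + 1) * Y = (∑ k ∈ t, |x k|) ^ (i + 1) / Y ^ i := by
    rw [pow_succ Y]; field_simp
  rw [this]
  gcongr
  exact Finset.abs_sum_le_sum_abs _ _

variable {n : ℕ}

/-- For fixed l, swapping i and l is a bijection from the batches containing i to those containing
l. Summed over l, every m-element batch is hit once for each of its m elements. -/
lemma sum_sum_map_swap {M : Type*} [AddCommMonoid M] (m : ℕ) (i : Fin n)
    (f : Finset (Fin n) → M) :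
    ∑ B ∈ (Finset.powersetCard m Finset.univ).filter (i ∈ ·), ∑ l,
        f (B.map (Equiv.swap i l).toEmbedding) =
      m • ∑ B ∈ Finset.powersetCard m Finset.univ, f B := by
  rw [Finset.sum_comm]
  have h : ∀ l : Fin n, ∑ B ∈ (Finset.powersetCard m Finset.univ).filter (i ∈ ·),
        f (B.map (Equiv.swap i l).toEmbedding) =
      ∑ B ∈ Finset.powersetCard m Finset.univ, if l ∈ B then f B else 0 := by
    intro l
    rw [← Finset.sum_filter]
    have hinv : ∀ B : Finset (Fin n),
        (B.map (Equiv.swap i l).toEmbedding).map (Equiv.swap i l).toEmbedding = B := by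
      intro B
      ext x
      simp [Finset.mem_map_equiv]
    refine Finset.sum_nbij' (fun B => B.map (Equiv.swap i l).toEmbedding)
      (fun B => B.map (Equiv.swap i l).toEmbedding) ?_ ?_ ?_ ?_ ?_
    · intro B hB
      simp only [Finset.mem_filter, Finset.mem_powersetCard_univ, Finset.card_map,
        Finset.mem_map_equiv, Equiv.symm_swap, Equiv.swap_apply_right] at hB ⊢
      exact hB
    · intro B hB
      simp only [Finset.mem_filter, Finset.mem_powersetCard_univ, Finset.card_map,
        Finset.mem_map_equiv, Equiv.symm_swap, Equiv.swap_apply_left] at hB ⊢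
      exact hB
    · exact fun B _ => hinv B
    · exact fun B _ => hinv B
    · exact fun B _ => rfl
  simp_rw [h]
  rw [Finset.sum_comm, Finset.smul_sum]
  refine Finset.sum_congr rfl fun B hB => ?_
  rw [Finset.sum_ite_mem, Finset.univ_inter, Finset.sum_const,
    (Finset.mem_powersetCard_univ.1 hB)]

variable {E : Type*} [NormedAddCommGroup E]

lemma norm_sum_sub_sum_le {R : ℝ} {v v' : Fin n → E} (hv : ∀ j, ‖v j‖ ≤ R / 2)
    (hv' : ∀ j, ‖v' j‖ ≤ R / 2) {i : Fin n} (hvv' : ∀ j, j ≠ i → v j = v' j)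
    {B : Finset (Fin n)} (hi : i ∈ B) : ‖∑ j ∈ B, v j - ∑ j ∈ B, v' j‖ ≤ R := by
  rw [← Finset.add_sum_erase _ _ hi, ← Finset.add_sum_erase _ v' hi,
    Finset.sum_congr rfl fun j hj => hvv' j (Finset.ne_of_mem_erase hj), add_sub_add_right_eq_sub]
  linarith [norm_sub_le (v i) (v' i), hv i, hv' i]

/-- If l ∈ B the swap fixes B and only the entry i differs; otherwise the term v i is exchanged for
v' l. Either way one term of each sum survives in the difference. -/
lemma norm_sum_sub_sum_swap_le {R : ℝ} {v v' : Fin n → E} (hv : ∀ j, ‖v j‖ ≤ R / 2)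
    (hv' : ∀ j, ‖v' j‖ ≤ R / 2) {i : Fin n} (hvv' : ∀ j, j ≠ i → v j = v' j)
    {B : Finset (Fin n)} (hi : i ∈ B) (l : Fin n) :
    ‖∑ j ∈ B, v j - ∑ j ∈ B.map (Equiv.swap i l).toEmbedding, v' j‖ ≤ R := by
  by_cases hl : l ∈ B
  · have : B.map (Equiv.swap i l).toEmbedding = B := by
      ext x
      rw [Finset.mem_map_equiv, Equiv.symm_swap]
      by_cases hxi : x = i
      · simp [hxi, hi, hl]
      by_cases hxl : x = l
      · simp [hxl, hi, hl]
      rw [Equiv.swap_apply_of_ne_of_ne hxi hxl]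
    rw [this]
    exact norm_sum_sub_sum_le hv hv' hvv' hi
  · rw [Finset.sum_map, ← Finset.add_sum_erase _ _ hi, ← Finset.add_sum_erase B _ hi]
    have : ∑ j ∈ B.erase i, v j = ∑ j ∈ B.erase i, v' ((Equiv.swap i l).toEmbedding j) := by
      refine Finset.sum_congr rfl fun j hj => ?_
      have hji := Finset.ne_of_mem_erase hj
      have hjl : j ≠ l := fun h => hl (h ▸ Finset.mem_of_mem_erase hj)
      rw [hvv' j hji, Equiv.coe_toEmbedding, Equiv.swap_apply_of_ne_of_ne hji hjl]
    rw [this, add_sub_add_right_eq_sub]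
    simp only [Equiv.coe_toEmbedding, Equiv.swap_apply_left]
    linarith [norm_sub_le (v i) (v' l), hv i, hv' l]

variable [InnerProductSpace ℝ E] [FiniteDimensional ℝ E] [MeasurableSpace E] [BorelSpace E]

lemma lintegral_gaussianDensity_pow_le {R : ℝ} {c c' : E} (h : ‖c - c'‖ ≤ R) {j : ℕ}
    (hj : 1 ≤ j) :
    ∫⁻ y, ENNReal.ofReal (gaussianDensity c y ^ j / gaussianDensity c' y ^ (j - 1))
      ∂(stdGaussian E) ≤ ENNReal.ofReal (Real.exp (((j : ℝ) - 1) * (j * R ^ 2 / 2))) := by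
  have h1 := lintegral_gaussianDensity_rpow (j : ℝ) c c'
  have h2 : ∀ y, gaussianDensity c y ^ (j : ℝ) * gaussianDensity c' y ^ (1 - (j : ℝ)) =
      gaussianDensity c y ^ j / gaussianDensity c' y ^ (j - 1) := fun y => by
    rw [Real.rpow_natCast, ← neg_sub, Real.rpow_neg (gaussianDensity_pos _ _).le,
      ← Nat.cast_one, ← Nat.cast_sub hj, Real.rpow_natCast, div_eq_mul_inv]
  simp_rw [h2] at h1
  rw [h1]
  have hj' : (1 : ℝ) ≤ j := by exact_mod_cast hj
  have h3 : ‖c - c'‖ ^ 2 ≤ R ^ 2 := by gcongr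
  have h4 : 0 ≤ (j : ℝ) * (j - 1) / 2 := by
    have : (0 : ℝ) ≤ j - 1 := by linarith
    positivity
  refine ENNReal.ofReal_le_ofReal (Real.exp_le_exp.2 ?_)
  calc (j : ℝ) * (j - 1) / 2 * ‖c - c'‖ ^ 2 ≤ (j : ℝ) * (j - 1) / 2 * R ^ 2 := by gcongr
    _ = _ := by ring

/-- For nonnegative numbers |p₁ - p₂|^j ≤ p₁^j + p₂^j, which is the origin of the factor 2. -/
lemma lintegral_abs_sub_pow_le {R : ℝ} {c₁ c₂ c₃ : E} (h₁ : ‖c₁ - c₃‖ ≤ R) (h₂ : ‖c₂ - c₃‖ ≤ R)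
    {j : ℕ} (hj : 1 ≤ j) :
    ∫⁻ y, ENNReal.ofReal (|gaussianDensity c₁ y - gaussianDensity c₂ y| ^ j /
        gaussianDensity c₃ y ^ (j - 1)) ∂(stdGaussian E) ≤
      ENNReal.ofReal (2 * Real.exp (((j : ℝ) - 1) * (j * R ^ 2 / 2))) := by
  calc ∫⁻ y, ENNReal.ofReal (|gaussianDensity c₁ y - gaussianDensity c₂ y| ^ j /
        gaussianDensity c₃ y ^ (j - 1)) ∂(stdGaussian E)
      ≤ ∫⁻ y, (ENNReal.ofReal (gaussianDensity c₁ y ^ j / gaussianDensity c₃ y ^ (j - 1)) +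
        ENNReal.ofReal (gaussianDensity c₂ y ^ j / gaussianDensity c₃ y ^ (j - 1)))
          ∂(stdGaussian E) := by
        refine lintegral_mono fun y => ?_
        have p1 := gaussianDensity_pos c₁ y
        have p2 := gaussianDensity_pos c₂ y
        have p3 := gaussianDensity_pos c₃ y
        rw [← ENNReal.ofReal_add (by positivity) (by positivity), ← add_div]
        refine ENNReal.ofReal_le_ofReal ?_
        gcongr
        rcases le_total (gaussianDensity c₁ y) (gaussianDensity c₂ y) with h | h
        · calc |gaussianDensity c₁ y - gaussianDensity c₂ y| ^ j ≤ gaussianDensity c₂ y ^ j := by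
                gcongr
                rw [abs_le]; constructor <;> linarith
            _ ≤ _ := by linarith [pow_pos p1 j]
        · calc |gaussianDensity c₁ y - gaussianDensity c₂ y| ^ j ≤ gaussianDensity c₁ y ^ j := by
                gcongr
                rw [abs_le]; constructor <;> linarith
            _ ≤ _ := by linarith [pow_pos p2 j]
    _ ≤ _ := by
        rw [lintegral_add_left (by fun_prop), two_mul, ENNReal.ofReal_add (by positivity)
          (by positivity)]
        exact add_le_add (lintegral_gaussianDensity_pow_le h₁ hj)
          (lintegral_gaussianDensity_pow_le h₂ hj)

lemma lintegral_sub_sq_le {R : ℝ} {c c' : E} (h : ‖c - c'‖ ≤ R) :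
    ∫⁻ y, ENNReal.ofReal ((gaussianDensity c y - gaussianDensity c' y) ^ 2 /
      gaussianDensity c' y) ∂(stdGaussian E) ≤ ENNReal.ofReal (Real.exp (R ^ 2) - 1) := by
  -- Expanding the square with the cross term 2p moved to the left avoids subtraction in `ℝ≥0∞`;
  -- both densities have mass 1, so one unit cancels.
  have h1 : ∫⁻ y, (ENNReal.ofReal ((gaussianDensity c y - gaussianDensity c' y) ^ 2 /
        gaussianDensity c' y) + 2 * ENNReal.ofReal (gaussianDensity c y)) ∂(stdGaussian E) =
      ∫⁻ y, (ENNReal.ofReal (gaussianDensity c y ^ 2 / gaussianDensity c' y ^ (2 - 1)) +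
        ENNReal.ofReal (gaussianDensity c' y)) ∂(stdGaussian E) := by
    refine lintegral_congr fun y => ?_
    have p1 := gaussianDensity_pos c y
    have p2 := gaussianDensity_pos c' y
    rw [← ENNReal.ofReal_ofNat 2, ← ENNReal.ofReal_mul (by norm_num),
      ← ENNReal.ofReal_add (by positivity) (by positivity),
      ← ENNReal.ofReal_add (by positivity) (by positivity)]
    congr 1
    field_simp
    ring
  rw [lintegral_add_right _ (by fun_prop), lintegral_add_right _ (by fun_prop),
    lintegral_const_mul _ (by fun_prop), lintegral_gaussianDensity,
    lintegral_gaussianDensity, mul_one] at h1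
  have h2 := lintegral_gaussianDensity_pow_le h (j := 2) (by norm_num)
  have h3 : (((2 : ℕ) : ℝ) - 1) * ((2 : ℕ) * R ^ 2 / 2) = R ^ 2 := by push_cast; ring
  rw [h3] at h2
  have h4 : (2 : ℝ≥0∞) = 1 + 1 := by norm_num
  have h5 : 1 ≤ Real.exp (R ^ 2) := Real.one_le_exp (sq_nonneg R)
  rw [h4, ← add_assoc, ENNReal.add_left_inj ENNReal.one_ne_top] at h1
  rw [ENNReal.ofReal_sub _ zero_le_one, ENNReal.ofReal_one]
  refine ENNReal.le_sub_of_add_le_right ENNReal.one_ne_top ?_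
  rw [h1]
  exact h2

/-- For j = 2, (a - b)² ≤ 2a² + 2b² with p₃ as midpoint reduces to two χ²-divergences. Unlike the
generic bound, the result vanishes as R → 0. -/
lemma lintegral_abs_sub_sq_le {R : ℝ} {c₁ c₂ c₃ : E} (h₁ : ‖c₁ - c₃‖ ≤ R) (h₂ : ‖c₂ - c₃‖ ≤ R) :
    ∫⁻ y, ENNReal.ofReal (|gaussianDensity c₁ y - gaussianDensity c₂ y| ^ 2 /
        gaussianDensity c₃ y ^ (2 - 1)) ∂(stdGaussian E) ≤
      ENNReal.ofReal (4 * (Real.exp (R ^ 2) - 1)) := by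
  have h5 : 0 ≤ Real.exp (R ^ 2) - 1 := by linarith [Real.one_le_exp (sq_nonneg R)]
  calc ∫⁻ y, ENNReal.ofReal (|gaussianDensity c₁ y - gaussianDensity c₂ y| ^ 2 /
        gaussianDensity c₃ y ^ (2 - 1)) ∂(stdGaussian E)
      ≤ ∫⁻ y, (2 * ENNReal.ofReal ((gaussianDensity c₁ y - gaussianDensity c₃ y) ^ 2 /
          gaussianDensity c₃ y) +
        2 * ENNReal.ofReal ((gaussianDensity c₂ y - gaussianDensity c₃ y) ^ 2 /
          gaussianDensity c₃ y)) ∂(stdGaussian E) := by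
        refine lintegral_mono fun y => ?_
        have p3 := gaussianDensity_pos c₃ y
        rw [← ENNReal.ofReal_ofNat 2, ← ENNReal.ofReal_mul (by norm_num),
          ← ENNReal.ofReal_mul (by norm_num), ← ENNReal.ofReal_add (by positivity) (by positivity),
          sq_abs]
        refine ENNReal.ofReal_le_ofReal ?_
        rw [← mul_div_assoc, ← mul_div_assoc, ← add_div, pow_one]
        gcongr
        nlinarith [sq_nonneg (gaussianDensity c₁ y - gaussianDensity c₃ y +
          (gaussianDensity c₂ y - gaussianDensity c₃ y))]
    _ ≤ 2 * ENNReal.ofReal (Real.exp (R ^ 2) - 1) + 2 * ENNReal.ofReal (Real.exp (R ^ 2) - 1) := by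
        rw [lintegral_add_left (by fun_prop), lintegral_const_mul _ (by fun_prop),
          lintegral_const_mul _ (by fun_prop)]
        gcongr
        · exact lintegral_sub_sq_le h₁
        · exact lintegral_sub_sq_le h₂
    _ = _ := by
        rw [← ENNReal.ofReal_ofNat 2, ← ENNReal.ofReal_mul (by norm_num),
          ← ENNReal.ofReal_add (by positivity) (by positivity)]
        congr 1
        ring

/-- A bound on `∫ |p₁ - p₂| ^ j / p₃ ^ (j - 1)` for Gaussian densities `p₁, p₂, p₃` with covariance
`I` whose centres have distance at most `2 / κ`. -/
noncomputable def ternaryBound (κ : ℝ) (j : ℕ) : ℝ :=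
  if j = 2 then min (4 * (Real.exp (2 * 2 / κ ^ 2) - 1)) (2 * Real.exp (2 * 2 / κ ^ 2))
  else 2 * Real.exp (((j : ℝ) - 1) * (2 * j / κ ^ 2))

lemma ternaryBound_nonneg (κ : ℝ) (j : ℕ) : 0 ≤ ternaryBound κ j := by
  unfold ternaryBound
  split_ifs
  · refine le_min ?_ (by positivity)
    have : 1 ≤ Real.exp (2 * 2 / κ ^ 2) := Real.one_le_exp (by positivity)
    linarith
  · positivity

lemma lintegral_le_ternaryBound {κ : ℝ} {c₁ c₂ c₃ : E} (h₁ : ‖c₁ - c₃‖ ≤ 2 / κ)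
    (h₂ : ‖c₂ - c₃‖ ≤ 2 / κ) {j : ℕ} (hj : 1 ≤ j) :
    ∫⁻ y, ENNReal.ofReal (|gaussianDensity c₁ y - gaussianDensity c₂ y| ^ j /
        gaussianDensity c₃ y ^ (j - 1)) ∂(stdGaussian E) ≤ ENNReal.ofReal (ternaryBound κ j) := by
  have h := lintegral_abs_sub_pow_le h₁ h₂ hj
  unfold ternaryBound
  split_ifs with hj2
  · subst hj2
    rw [ENNReal.ofReal_min]
    refine le_min ?_ ?_
    · refine (lintegral_abs_sub_sq_le h₁ h₂).trans_eq ?_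
      congr 4
      ring
    · refine h.trans_eq ?_
      congr 3
      push_cast
      ring
  · refine h.trans_eq ?_
    congr 4
    ring

end Amplification

/-! ### Amplification by subsampling for mixtures of Gaussians -/

section SubsampledGaussian

variable {E : Type*} [NormedAddCommGroup E] [InnerProductSpace ℝ E] {n : ℕ}

/-- The density with respect to `N(0, I)` of a uniform mixture of Gaussian laws `N(c_i, I)`. -/
noncomputable def mixtureDensity {ι : Type*} (t : Finset ι) (c : ι → E) (y : E) : ℝ :=
  (t.card : ℝ)⁻¹ * ∑ i ∈ t, gaussianDensity (c i) y

lemma mixtureDensity_pos {ι : Type*} {t : Finset ι} (ht : t.Nonempty) (c : ι → E) (y : E) :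
    0 < mixtureDensity t c y :=
  mul_pos (by simpa using ht) (Finset.sum_pos (fun _ _ => gaussianDensity_pos _ _) ht)

variable [FiniteDimensional ℝ E]
  [MeasurableSpace E] [BorelSpace E]

@[fun_prop]
lemma measurable_mixtureDensity {ι : Type*} (t : Finset ι) (c : ι → E) :
    Measurable (mixtureDensity t c) := by
  unfold mixtureDensity
  fun_prop

lemma uniformMixture_gaussian_eq_withDensity {ι : Type*} {t : Finset ι} (ht : t.Nonempty)
    (c : ι → E) :
    uniformMixture t (fun i => gaussian (c i) 1) =
      (stdGaussian E).withDensity fun y => ENNReal.ofReal (mixtureDensity t c y) := by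
  have hc : (0 : ℝ) < t.card := by simpa using ht
  refine Measure.ext_of_lintegral _ fun g hg => ?_
  rw [lintegral_uniformMixture, lintegral_withDensity_eq_lintegral_mul _ (by fun_prop) hg]
  simp_rw [lintegral_gaussian_one _ hg]
  rw [← lintegral_finsetSum _ (by fun_prop), ← lintegral_const_mul _ (by fun_prop)]
  refine lintegral_congr fun y => ?_
  simp only [Pi.mul_apply, mixtureDensity]
  rw [ENNReal.ofReal_mul (by positivity), ENNReal.ofReal_inv_of_pos hc, ENNReal.ofReal_natCast,
    ENNReal.ofReal_sum_of_nonneg (fun _ _ => (gaussianDensity_pos _ _).le), mul_assoc,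
    Finset.sum_mul]

lemma lintegral_mixtureDensity {ι : Type*} {t : Finset ι} (ht : t.Nonempty) (c : ι → E) :
    ∫⁻ y, ENNReal.ofReal (mixtureDensity t c y) ∂(stdGaussian E) = 1 := by
  have : IsProbabilityMeasure (uniformMixture t (fun i => gaussian (c i) 1)) :=
    isProbabilityMeasure_uniformMixture ht fun i _ => inferInstance
  rw [← setLIntegral_univ, ← withDensity_apply _ MeasurableSet.univ,
    ← uniformMixture_gaussian_eq_withDensity ht, measure_univ]

/-- Only batches containing i contribute to P - Q. Each is paired with every l: its difference p_B -
p'_B is compared with the density of the batch in which l replaces i. With N batches in all, the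
differences sum to nN(P - Q) and the reference densities to mN Q. Convexity then turns the mismatch
between n and m into (m/n)^j times an average of three-Gaussian moments. -/
lemma lintegral_abs_sub_mixtureDensity_pow_le {κ : ℝ} {v v' : Fin n → E}
    (hv : ∀ j, ‖v j‖ ≤ 1 / κ) (hv' : ∀ j, ‖v' j‖ ≤ 1 / κ) {i : Fin n}
    (hvv' : ∀ j, j ≠ i → v j = v' j) {m : ℕ} (hm : 0 < m) (hmn : m ≤ n) {j : ℕ} (hj : 1 ≤ j) :
    ∫⁻ y, ENNReal.ofReal (
        |mixtureDensity (Finset.powersetCard m Finset.univ) (fun B => ∑ j ∈ B, v j) y -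
          mixtureDensity (Finset.powersetCard m Finset.univ) (fun B => ∑ j ∈ B, v' j) y| ^ j /
        mixtureDensity (Finset.powersetCard m Finset.univ) (fun B => ∑ j ∈ B, v' j) y ^ (j - 1))
        ∂(stdGaussian E) ≤ ENNReal.ofReal (((m : ℝ) / n) ^ j * ternaryBound κ j) := by
  classical
  set S : Finset (Finset (Fin n)) := Finset.powersetCard m Finset.univ with hS
  set S' := S.filter (i ∈ ·) with hS'
  set t := S' ×ˢ (Finset.univ : Finset (Fin n)) with ht
  set c : Finset (Fin n) → E := fun B => ∑ j ∈ B, v j with hc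
  set c' : Finset (Fin n) → E := fun B => ∑ j ∈ B, v' j with hc'
  have hn : 0 < n := hm.trans_le hmn
  have hn' : (0 : ℝ) < n := by exact_mod_cast hn
  have hm' : (0 : ℝ) < m := by exact_mod_cast hm
  have hSne : S.Nonempty := Finset.powersetCard_nonempty.2 (by simpa using hmn)
  have hN : (0 : ℝ) < S.card := by simpa using hSne
  have hcard : t.card = m * S.card := by
    have := sum_sum_map_swap m i fun _ : Finset (Fin n) => 1
    simpa [ht, Finset.card_product, hS', hS] using this
  have htne : t.Nonempty := by
    rw [← Finset.card_pos, hcard]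
    exact Nat.mul_pos hm (Finset.card_pos.2 hSne)
  set x : E → Finset (Fin n) × Fin n → ℝ := fun y k =>
    gaussianDensity (c k.1) y - gaussianDensity (c' k.1) y with hx
  set z : E → Finset (Fin n) × Fin n → ℝ := fun y k =>
    gaussianDensity (c' (k.1.map (Equiv.swap i k.2).toEmbedding)) y with hz
  have hsumz : ∀ y, ∑ k ∈ t, z y k = m * S.card * mixtureDensity S c' y := by
    intro y
    rw [ht, Finset.sum_product, hS', hS]
    have h := sum_sum_map_swap m i fun B => gaussianDensity (c' B) y
    rw [nsmul_eq_mul] at h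
    rw [mixtureDensity, mul_assoc, ← hS, mul_inv_cancel_left₀ hN.ne']
    exact h
  have hsumx : ∀ y, ∑ k ∈ t, x y k =
      n * S.card * (mixtureDensity S c y - mixtureDensity S c' y) := by
    intro y
    have h1 : ∑ k ∈ t, x y k =
        n * ∑ B ∈ S', (gaussianDensity (c B) y - gaussianDensity (c' B) y) := by
      rw [ht, Finset.sum_product]
      simp [hx, ← Finset.mul_sum, mul_sub]
    have h2 : ∑ B ∈ S', (gaussianDensity (c B) y - gaussianDensity (c' B) y) =
        ∑ B ∈ S, (gaussianDensity (c B) y - gaussianDensity (c' B) y) := by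
      refine Finset.sum_subset (Finset.filter_subset _ _) fun B hB hB' => ?_
      have hi : i ∉ B := fun h => hB' (Finset.mem_filter.2 ⟨hB, h⟩)
      have : c B = c' B := Finset.sum_congr rfl fun j hj => hvv' j fun h => hi (h ▸ hj)
      rw [this, sub_self]
    rw [h1, h2, Finset.sum_sub_distrib, mixtureDensity, mixtureDensity, ← mul_sub, mul_assoc,
      mul_inv_cancel_left₀ hN.ne']
  obtain ⟨b, rfl⟩ : ∃ b, j = b + 1 := ⟨j - 1, by omega⟩
  -- The prefactor is n^(-j) m^(j-1) N^(-1), and mN is the number of pairs, so the right side is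
  -- (m/n)^j times an average.
  have hpt : ∀ y, |mixtureDensity S c y - mixtureDensity S c' y| ^ (b + 1) /
      mixtureDensity S c' y ^ (b + 1 - 1) ≤
        ((m : ℝ) / n) ^ (b + 1) * (m * S.card : ℝ)⁻¹ *
          ∑ k ∈ t, |x y k| ^ (b + 1) / z y k ^ (b + 1 - 1) := by
    intro y
    have hq := mixtureDensity_pos hSne c' y
    have h := abs_sum_pow_div_le t htne (x y) (z y) (fun k _ => gaussianDensity_pos _ _)
      (b + 1) hj
    rw [hsumx, hsumz, abs_mul, abs_of_pos (by positivity : (0 : ℝ) < n * S.card)] at h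
    refine le_trans (le_of_eq ?_) (mul_le_mul_of_nonneg_left h (by positivity))
    simp only [Nat.add_sub_cancel, mul_pow, div_pow]
    field_simp
    ring
  calc ∫⁻ y, ENNReal.ofReal (|mixtureDensity S c y - mixtureDensity S c' y| ^ (b + 1) /
        mixtureDensity S c' y ^ (b + 1 - 1)) ∂(stdGaussian E)
      ≤ ∫⁻ y, ENNReal.ofReal (((m : ℝ) / n) ^ (b + 1) * (m * S.card : ℝ)⁻¹) *
          ∑ k ∈ t, ENNReal.ofReal (|x y k| ^ (b + 1) / z y k ^ (b + 1 - 1)) ∂(stdGaussian E) := by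
        refine lintegral_mono fun y => ?_
        rw [← ENNReal.ofReal_sum_of_nonneg (fun k _ => div_nonneg (by positivity)
          (pow_nonneg (gaussianDensity_pos _ _).le _)), ← ENNReal.ofReal_mul (by positivity)]
        exact ENNReal.ofReal_le_ofReal (hpt y)
    _ = ENNReal.ofReal (((m : ℝ) / n) ^ (b + 1) * (m * S.card : ℝ)⁻¹) *
          ∑ k ∈ t, ∫⁻ y, ENNReal.ofReal (|x y k| ^ (b + 1) / z y k ^ (b + 1 - 1))
            ∂(stdGaussian E) := by
        have hmeas : ∀ k ∈ t, Measurable fun y =>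
            ENNReal.ofReal (|x y k| ^ (b + 1) / z y k ^ (b + 1 - 1)) := by
          intro k _
          simp only [hx, hz]
          fun_prop
        rw [lintegral_const_mul _ (Finset.measurable_fun_sum _ hmeas), lintegral_finsetSum _ hmeas]
    _ ≤ ENNReal.ofReal (((m : ℝ) / n) ^ (b + 1) * (m * S.card : ℝ)⁻¹) *
          ∑ k ∈ t, ENNReal.ofReal (ternaryBound κ (b + 1)) := by
        gcongr with k hk
        have hki : i ∈ k.1 := (Finset.mem_filter.1 (Finset.mem_product.1 hk).1).2
        have e : 1 / κ = 2 / κ / 2 := by ring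
        rw [e] at hv hv'
        refine lintegral_le_ternaryBound (norm_sum_sub_sum_swap_le hv hv' hvv' hki k.2) ?_ hj
        exact norm_sum_sub_sum_swap_le hv' hv' (fun _ _ => rfl) hki k.2
    _ = ENNReal.ofReal (((m : ℝ) / n) ^ (b + 1) * ternaryBound κ (b + 1)) := by
        rw [Finset.sum_const, hcard, nsmul_eq_mul, ← ENNReal.ofReal_natCast,
          ← ENNReal.ofReal_mul (by positivity), ← ENNReal.ofReal_mul (by positivity)]
        congr 1
        push_cast
        field_simp

/-- Privacy amplification by subsampling without replacement, for the Gaussian mechanism. -/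
lemma renyiDom_subsampled_gaussian {a : ℕ} (ha : 2 ≤ a) {κ : ℝ} {v v' : Fin n → E}
    (hv : ∀ j, ‖v j‖ ≤ 1 / κ) (hv' : ∀ j, ‖v' j‖ ≤ 1 / κ) {i : Fin n}
    (hvv' : ∀ j, j ≠ i → v j = v' j) {m : ℕ} (hmn : m ≤ n) :
    RenyiDom (((a : ℝ) - 1) / a)
      (ENNReal.ofReal (1 + ∑ j ∈ Finset.Icc 2 a,
        ((m : ℝ) / n) ^ j * (a.choose j : ℝ) * ternaryBound κ j) ^ (1 / (a : ℝ)))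
      (uniformMixture (Finset.powersetCard m Finset.univ) fun B => gaussian (∑ j ∈ B, v j) 1)
      (uniformMixture (Finset.powersetCard m Finset.univ) fun B => gaussian (∑ j ∈ B, v' j) 1) := by
  have ha' : (2 : ℝ) ≤ a := by exact_mod_cast ha
  have hsum : 0 ≤ ∑ j ∈ Finset.Icc 2 a,
      ((m : ℝ) / n) ^ j * (a.choose j : ℝ) * ternaryBound κ j :=
    Finset.sum_nonneg fun j _ => mul_nonneg (by positivity) (ternaryBound_nonneg κ j)
  set S : Finset (Finset (Fin n)) := Finset.powersetCard m Finset.univ with hS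
  have hSne : S.Nonempty := Finset.powersetCard_nonempty.2 (by simpa using hmn)
  rcases Nat.eq_zero_or_pos m with hm0 | hm
  -- Empty batches: both laws coincide, and there are no pairs to average over.
  · have hPQ : (uniformMixture S fun B => gaussian (∑ j ∈ B, v j) 1) =
        uniformMixture S fun B => gaussian (∑ j ∈ B, v' j) 1 := by
      refine uniformMixture_congr fun B hB => ?_
      have : B = ∅ := by simpa [hS, hm0] using hB
      simp [this]
    rw [hPQ]
    have : IsProbabilityMeasure (uniformMixture S fun B => gaussian (∑ j ∈ B, v' j) 1) :=
      isProbabilityMeasure_uniformMixture hSne fun i _ => inferInstance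
    refine (RenyiDom.refl (div_pos (by linarith) (by linarith)) ?_ _).mono ?_
    · rw [div_lt_one (by linarith)]; linarith
    · exact ENNReal.one_le_rpow (by simpa using hsum) (by positivity)
  · rw [uniformMixture_gaussian_eq_withDensity hSne, uniformMixture_gaussian_eq_withDensity hSne]
    set p := mixtureDensity S fun B => ∑ j ∈ B, v j with hp
    set q := mixtureDensity S fun B => ∑ j ∈ B, v' j with hq
    have hpm : Measurable p := measurable_mixtureDensity _ _
    have hqm : Measurable q := measurable_mixtureDensity _ _
    have hp0 : ∀ y, 0 < p y := mixtureDensity_pos hSne _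
    have hq0 : ∀ y, 0 < q y := mixtureDensity_pos hSne _
    refine RenyiDom.of_density (by linarith) (by fun_prop) (by fun_prop) (by simp [hq0]) (by simp) ?_
    have h1 : ∀ y, ENNReal.ofReal (p y) ^ (a : ℝ) * ENNReal.ofReal (q y) ^ (1 - (a : ℝ)) =
        ENNReal.ofReal (p y ^ a / q y ^ (a - 1)) := by
      intro y
      rw [ENNReal.ofReal_rpow_of_pos (hp0 y), ENNReal.ofReal_rpow_of_pos (hq0 y),
        ← ENNReal.ofReal_mul (Real.rpow_nonneg (hp0 y).le _)]
      rw [Real.rpow_natCast, ← neg_sub, Real.rpow_neg (hq0 y).le,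
        ← Nat.cast_one, ← Nat.cast_sub (by omega), Real.rpow_natCast, div_eq_mul_inv]
    simp_rw [h1]
    have hI : ∫⁻ y, (ENNReal.ofReal (p y ^ a / q y ^ (a - 1)) +
          ENNReal.ofReal ((a : ℝ) - 1) * ENNReal.ofReal (q y)) ∂(stdGaussian E) ≤
        ∫⁻ y, (ENNReal.ofReal a * ENNReal.ofReal (p y) + ∑ j ∈ Finset.Icc 2 a,
          ENNReal.ofReal (a.choose j : ℝ) * ENNReal.ofReal (|p y - q y| ^ j / q y ^ (j - 1)))
          ∂(stdGaussian E) := by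
      refine lintegral_mono fun y => ?_
      have hpy := hp0 y
      have hqy := hq0 y
      have ha1 : (0 : ℝ) ≤ a - 1 := by linarith
      simp_rw [← ENNReal.ofReal_mul (Nat.cast_nonneg _)]
      rw [← ENNReal.ofReal_mul ha1, ← ENNReal.ofReal_add (by positivity) (by positivity),
        ← ENNReal.ofReal_sum_of_nonneg (fun _ _ => by positivity),
        ← ENNReal.ofReal_add (by positivity) (by positivity)]
      exact ENNReal.ofReal_le_ofReal (pow_div_pow_add_le hqy ha)
    rw [lintegral_add_right _ (by fun_prop), lintegral_const_mul _ (by fun_prop),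
      lintegral_mixtureDensity hSne, lintegral_add_left (by fun_prop),
      lintegral_const_mul _ (by fun_prop), lintegral_mixtureDensity hSne,
      lintegral_finsetSum _ (by fun_prop), mul_one, mul_one] at hI
    have hJ : ∑ j ∈ Finset.Icc 2 a, ∫⁻ y, ENNReal.ofReal (a.choose j : ℝ) *
          ENNReal.ofReal (|p y - q y| ^ j / q y ^ (j - 1)) ∂(stdGaussian E) ≤
        ENNReal.ofReal (∑ j ∈ Finset.Icc 2 a,
          ((m : ℝ) / n) ^ j * (a.choose j : ℝ) * ternaryBound κ j) := by
      rw [ENNReal.ofReal_sum_of_nonneg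
        (fun j _ => mul_nonneg (by positivity) (ternaryBound_nonneg κ j))]
      refine Finset.sum_le_sum fun j hj => ?_
      have hj1 : 1 ≤ j := by have := Finset.mem_Icc.1 hj; omega
      rw [lintegral_const_mul _ (by fun_prop), mul_right_comm, mul_comm _ (a.choose j : ℝ),
        ENNReal.ofReal_mul (Nat.cast_nonneg _)]
      gcongr
      exact lintegral_abs_sub_mixtureDensity_pow_le hv hv' hvv' hm hmn hj1
    have hfin := hI.trans (add_le_add_right hJ _)
    -- The masses of p and q leave a on the right and a - 1 on the left; cancelling leaves the
    -- leading 1 of the bound.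
    have e : ENNReal.ofReal (a : ℝ) = 1 + ENNReal.ofReal ((a : ℝ) - 1) := by
      rw [← ENNReal.ofReal_one, ← ENNReal.ofReal_add zero_le_one (by linarith)]
      congr 1
      ring
    rw [e, add_right_comm, ENNReal.add_le_add_iff_right ENNReal.ofReal_ne_top] at hfin
    rwa [ENNReal.ofReal_add zero_le_one hsum, ENNReal.ofReal_one]

end SubsampledGaussian

/-! ### The two privacy curves and the smallest noise multiplier -/

section Curves

lemma norm_clip_le {E : Type*} [NormedAddCommGroup E] [NormedSpace ℝ E] (x : E) {ξ : ℝ}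
    (hξ : 0 ≤ ξ) : ‖clip x ξ‖ ≤ ξ := by
  rcases eq_or_ne x 0 with rfl | hx
  · simpa [clip] using hξ
  · have hx' : 0 < ‖x‖ := norm_pos_iff.2 hx
    have h0 : 0 ≤ min (ξ / ‖x‖) 1 := le_min (by positivity) zero_le_one
    rw [clip, norm_smul, Real.norm_of_nonneg h0]
    calc min (ξ / ‖x‖) 1 * ‖x‖ ≤ ξ / ‖x‖ * ‖x‖ := by gcongr; exact min_le_left _ _
      _ = ξ := by field_simp

lemma norm_inv_smul_clip_le {E : Type*} [NormedAddCommGroup E] [NormedSpace ℝ E] (x : E)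
    {ξ σ : ℝ} (hξ : 0 < ξ) (hσ : 0 < σ) : ‖σ⁻¹ • clip x ξ‖ ≤ 1 / (σ / ξ) := by
  rw [norm_smul, Real.norm_of_nonneg (by positivity)]
  calc σ⁻¹ * ‖clip x ξ‖ ≤ σ⁻¹ * ξ := by gcongr; exact norm_clip_le x hξ.le
    _ = _ := by field_simp

lemma batches_nonempty (n m : ℕ) : (batches n m).Nonempty :=
  Finset.powersetCard_nonempty.2 (by simp)

instance isProbabilityMeasure_subsampledGaussian (d n : ℕ) (γ ξ σ : ℝ)
    (x : Fin n → EuclideanSpace ℝ (Fin d)) :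
    IsProbabilityMeasure (subsampledGaussian d n γ ξ σ x) :=
  isProbabilityMeasure_uniformMixture (batches_nonempty _ _) fun _ _ => inferInstance

/-- The subsampled Gaussian mechanism is private at the level given by the curve `eps`. -/
def IsPrivacyCurve (α : ℝ) (eps : ℝ → ℝ → ℝ) : Prop :=
  ∀ (d n : ℕ) (γ ξ σ : ℝ), 0 ≤ γ → 0 < ξ → 0 < σ →
    ∀ x x' : Fin n → EuclideanSpace ℝ (Fin d), ReplaceOne x x' →
      RenyiDom ((α - 1) / α) (ENNReal.ofReal (Real.exp ((α - 1) / α * eps γ (σ / ξ))))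
        (subsampledGaussian d n γ ξ σ x) (subsampledGaussian d n γ ξ σ x')

/-- Conditionally on the batch this is a Gaussian mechanism of sensitivity at most 2ξ; no
amplification is used. It shows that the infimum in `epsSG` runs over a nonempty set, hence is not a
default value. -/
lemma isRDP_subsampledGaussian {α : ℝ} (hα : 1 < α) {d n : ℕ} {γ ξ σ : ℝ} (hξ : 0 < ξ)
    (hσ : 0 < σ) : IsRDP α (2 * α / (σ / ξ) ^ 2) (subsampledGaussian d n γ ξ σ) := by
  have hα0 : 0 < α := by linarith
  have hs0 : 0 < (α - 1) / α := div_pos (by linarith) hα0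
  have hs1 : (α - 1) / α < 1 := by rw [div_lt_one hα0]; linarith
  refine ⟨fun _ => inferInstance, fun x x' ⟨i, hi⟩ => renyiDiv_le_of_renyiDom hα ?_⟩
  refine RenyiDom.uniformMixture hs0 hs1 (batches_nonempty _ _) fun B _ => ?_
  refine (renyiDom_gaussian hα hσ.ne' _ _).mono (ENNReal.ofReal_le_ofReal (Real.exp_le_exp.2 ?_))
  have hR : 0 < σ / ξ := by positivity
  have hv : ∀ x : Fin n → EuclideanSpace ℝ (Fin d), ∀ j, ‖σ⁻¹ • clip (x j) ξ‖ ≤ 2 / (σ / ξ) / 2 :=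
    fun x j => (norm_inv_smul_clip_le (x j) hξ hσ).trans_eq (by ring)
  have h : ‖σ⁻¹ • (∑ j ∈ B, clip (x j) ξ - ∑ j ∈ B, clip (x' j) ξ)‖ ≤ 2 / (σ / ξ) := by
    by_cases hB : i ∈ B
    · rw [smul_sub, Finset.smul_sum, Finset.smul_sum]
      exact norm_sum_sub_sum_le (hv x) (hv x') (fun j hj => by rw [hi j hj]) hB
    · rw [Finset.sum_congr rfl fun j hj => by rw [hi j fun h => hB (h ▸ hj)]]
      simp only [sub_self, smul_zero, norm_zero]
      positivity
  gcongr (α - 1) / α * ?_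
  calc α * ‖σ⁻¹ • (∑ j ∈ B, clip (x j) ξ - ∑ j ∈ B, clip (x' j) ξ)‖ ^ 2 / 2
      ≤ α * (2 / (σ / ξ)) ^ 2 / 2 := by gcongr
    _ = _ := by ring

lemma isPrivacyCurve_epsSG {α : ℝ} (hα : 1 < α) : IsPrivacyCurve α (epsSG α) := by
  intro d n γ ξ σ _ hξ hσ x x' hx
  have hs0 : 0 < (α - 1) / α := div_pos (by linarith) (by linarith)
  have hκ : 0 < σ / ξ := by positivity
  refine RenyiDom.of_forall_gt fun ε' hε' => ?_
  have hne : {ε : ℝ | 0 < ε ∧ ∀ (d n : ℕ) (ξ' σ' : ℝ), 0 < ξ' → 0 < σ' → σ' / ξ' = σ / ξ →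
      IsRDP α ε (subsampledGaussian d n γ ξ' σ')}.Nonempty :=
    ⟨2 * α / (σ / ξ) ^ 2, by positivity, fun d n ξ' σ' hξ' hσ' h => by
      rw [← h]; exact isRDP_subsampledGaussian hα hξ' hσ'⟩
  obtain ⟨ε, hε, hεε'⟩ := exists_lt_of_csInf_lt hne hε'
  refine (renyiDom_of_renyiDiv_le hα ((hε.2 d n ξ σ hξ hσ rfl).2 x x' hx)).mono ?_
  gcongr

lemma one_add_sum_eq {a : ℕ} (ha : 2 ≤ a) (γ κ : ℝ) :
    1 + ∑ j ∈ Finset.Icc 2 a, γ ^ j * (a.choose j : ℝ) * ternaryBound κ j =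
      1 + γ ^ 2 * (a.choose 2 : ℝ) *
        min (4 * (Real.exp (2 * 2 / κ ^ 2) - 1)) (2 * Real.exp (2 * 2 / κ ^ 2))
      + ∑ j ∈ Finset.Icc 3 a,
        γ ^ j * (a.choose j : ℝ) * (2 * Real.exp (((j : ℝ) - 1) * (2 * j / κ ^ 2))) := by
  have h : Finset.Icc 2 a = insert 2 (Finset.Icc 3 a) := by
    ext j; simp; omega
  rw [h, Finset.sum_insert (by simp), add_assoc]
  congr 2
  refine Finset.sum_congr rfl fun j hj => ?_
  have : j ≠ 2 := by have := Finset.mem_Icc.1 hj; omega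
  simp [ternaryBound, this]

lemma isPrivacyCurve_epsClosed {a : ℕ} (ha : 2 ≤ a) : IsPrivacyCurve a (epsClosed a) := by
  intro d n γ ξ σ hγ hξ hσ x x' ⟨i, hi⟩
  have ha' : (2 : ℝ) ≤ a := by exact_mod_cast ha
  unfold subsampledGaussian batches
  set m := min ⌊γ * n⌋₊ n with hm
  -- The realized rate may fall below γ through the floor or the cap at n; the closed form is
  -- monotone in the rate.
  have hmγ : (m : ℝ) / n ≤ γ := by
    refine div_le_of_le_mul₀ (by positivity) hγ ?_
    calc (m : ℝ) ≤ (⌊γ * n⌋₊ : ℕ) := by exact_mod_cast min_le_left _ _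
      _ ≤ γ * n := Nat.floor_le (by positivity)
  have hdom := (renyiDom_subsampled_gaussian ha (κ := σ / ξ)
    (v := fun j => σ⁻¹ • clip (x j) ξ) (v' := fun j => σ⁻¹ • clip (x' j) ξ)
    (fun j => norm_inv_smul_clip_le _ hξ hσ) (fun j => norm_inv_smul_clip_le _ hξ hσ)
    (i := i) (fun j hj => by rw [hi j hj]) (m := m) (min_le_right _ _)).map
    (f := fun y => σ • y) (by fun_prop)
  rw [map_uniformMixture _ _ (by fun_prop), map_uniformMixture _ _ (by fun_prop)] at hdom
  simp_rw [← Finset.smul_sum, ← gaussian_eq_map_gaussian_one _ hσ.ne'] at hdom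
  refine hdom.mono ?_
  have hpos : ∀ r : ℝ, 0 ≤ r → 0 < 1 + ∑ j ∈ Finset.Icc 2 a,
      r ^ j * (a.choose j : ℝ) * ternaryBound (σ / ξ) j := fun r hr =>
    add_pos_of_pos_of_nonneg one_pos
      (Finset.sum_nonneg fun j _ => mul_nonneg (by positivity) (ternaryBound_nonneg _ j))
  have hlog : (((a : ℝ) - 1) / a * epsClosed a γ (σ / ξ)) =
      Real.log (1 + ∑ j ∈ Finset.Icc 2 a,
        γ ^ j * (a.choose j : ℝ) * ternaryBound (σ / ξ) j) * (1 / a) := by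
    rw [one_add_sum_eq ha, epsClosed]
    have h1 : (a : ℝ) - 1 ≠ 0 := by linarith
    have h2 : (a : ℝ) ≠ 0 := by linarith
    field_simp
  rw [hlog, ← Real.rpow_def_of_pos (hpos γ hγ), ENNReal.ofReal_rpow_of_pos (hpos _ (by positivity))]
  refine ENNReal.ofReal_le_ofReal (Real.rpow_le_rpow (hpos _ (by positivity)).le ?_ (by positivity))
  gcongr with j hj
  exact ternaryBound_nonneg _ j

/-- At the smallest noise multiplier that meets a budget, the budget is still met. -/
lemma renyiDom_noiseMultiplier {α : ℝ} (hα : 1 < α) {eps : ℝ → ℝ → ℝ}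
    (heps : IsPrivacyCurve α eps) {d n : ℕ} {γ ε σ : ℝ} (hγ : 0 ≤ γ) (hσ : 0 < σ)
    (hκ : noiseMultiplier eps γ ε ≠ 0) {x x' : Fin n → EuclideanSpace ℝ (Fin d)}
    (hx : ReplaceOne x x') :
    RenyiDom ((α - 1) / α) (ENNReal.ofReal (Real.exp ((α - 1) / α * ε)))
      (subsampledGaussian d n γ (σ / noiseMultiplier eps γ ε) σ x)
      (subsampledGaussian d n γ (σ / noiseMultiplier eps γ ε) σ x') := by
  have hs0 : 0 < (α - 1) / α := div_pos (by linarith) (by linarith)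
  -- An infeasible budget would give the default value `sInf ∅ = 0`, which `hκ` excludes.
  have hne : {κ : ℝ | 0 < κ ∧ eps γ κ ≤ ε}.Nonempty := by
    by_contra h
    rw [Set.not_nonempty_iff_eq_empty] at h
    exact hκ (by rw [noiseMultiplier, h, Real.sInf_empty])
  -- No continuity of `eps` in κ is assumed, so the budget is not passed to the limit through `eps`.
  -- Instead each u j meets it, and the mechanisms themselves converge as σ / u j tends to the
  -- limiting threshold.
  obtain ⟨u, -, hu, humem⟩ := exists_seq_tendsto_sInf hne ⟨0, fun κ hκ => hκ.1.le⟩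
  change Filter.Tendsto u Filter.atTop (nhds (noiseMultiplier eps γ ε)) at hu
  have hdom : ∀ j, RenyiDom ((α - 1) / α) (ENNReal.ofReal (Real.exp ((α - 1) / α * ε)))
      (subsampledGaussian d n γ (σ / u j) σ x) (subsampledGaussian d n γ (σ / u j) σ x') := by
    intro j
    have hj : 0 < u j := (humem j).1
    refine (heps d n γ (σ / u j) σ hγ (by positivity) hσ x x' hx).mono ?_
    rw [div_div_cancel₀ hσ.ne']
    have := (humem j).2
    gcongr
  have hlim : ∀ (x : Fin n → EuclideanSpace ℝ (Fin d)) (h : EuclideanSpace ℝ (Fin d) → ℝ≥0∞),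
      Measurable h → ∀ M : ℝ≥0∞, M ≠ ∞ → (∀ y, h y ≤ M) →
      Filter.Tendsto (fun j => ∫⁻ y, h y ∂(subsampledGaussian d n γ (σ / u j) σ x)) Filter.atTop
        (nhds (∫⁻ y, h y ∂(subsampledGaussian d n γ (σ / noiseMultiplier eps γ ε) σ x))) := by
    intro x h hh M hM hhM
    simp only [subsampledGaussian, lintegral_uniformMixture]
    refine ENNReal.Tendsto.const_mul (tendsto_finsetSum _ fun B _ => ?_)
      (Or.inr (by simpa using (batches_nonempty _ _).ne_empty))
    refine tendsto_lintegral_gaussian (tendsto_finsetSum _ fun i _ => ?_) hσ.ne' hh hM hhM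
    have hc : Filter.Tendsto (fun j => σ / u j) Filter.atTop
        (nhds (σ / noiseMultiplier eps γ ε)) := tendsto_const_nhds.div hu hκ
    have : Continuous fun ξ : ℝ => clip (x i) ξ := by unfold clip; fun_prop
    exact (this.tendsto _).comp hc
  refine RenyiDom.of_bounded hs0 fun g hg ⟨M, hM, hgM⟩ => ?_
  refine le_of_tendsto_of_tendsto' (hlim x _ (hg.pow_const _) (M ^ ((α - 1) / α)) ?_ ?_)
    (ENNReal.Tendsto.const_mul ((ENNReal.continuous_rpow_const.tendsto _).comp
      (hlim x' g hg M hM hgM)) (Or.inr ENNReal.ofReal_ne_top)) fun j => hdom j g hg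
  · exact ENNReal.rpow_ne_top_of_nonneg hs0.le hM
  · intro y
    gcongr
    exact hgM y

end Curves

/-! ### One iteration: isolating the group of the differing point -/

section Updates

/-- Redrawing one coordinate preserves the uniform law on a product; this allows conditioning on the
batches of all other groups. -/
lemma uniformMixture_piFinset {ι O : Type*} [MeasurableSpace O] [Fintype ι] [DecidableEq ι]
    {β : ι → Type*} (S : (g : ι) → Finset (β g)) (g : ι) (hg : (S g).Nonempty)
    (K : ((g : ι) → β g) → Measure O) :
    uniformMixture (Fintype.piFinset S) K = uniformMixture (Fintype.piFinset S) fun B =>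
      uniformMixture (S g) fun b => K (Function.update B g b) := by
  refine Measure.ext_of_lintegral _ fun f _ => ?_
  simp_rw [lintegral_uniformMixture]
  have h : ∑ B ∈ Fintype.piFinset S, ∑ b ∈ S g, ∫⁻ o, f o ∂(K (Function.update B g b)) =
      (S g).card * ∑ B ∈ Fintype.piFinset S, ∫⁻ o, f o ∂(K B) := by
    calc ∑ B ∈ Fintype.piFinset S, ∑ b ∈ S g, ∫⁻ o, f o ∂(K (Function.update B g b))
        = ∑ k ∈ Fintype.piFinset S ×ˢ S g, ∫⁻ o, f o ∂(K (Function.update k.1 g k.2)) := by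
          rw [Finset.sum_product]
      _ = ∑ k ∈ Fintype.piFinset S ×ˢ S g, ∫⁻ o, f o ∂(K k.1) := by
          -- Exchanging the old and the new entry at g is an involution of the index set.
          have hmem : ∀ k ∈ Fintype.piFinset S ×ˢ S g,
              (Function.update k.1 g k.2, k.1 g) ∈ Fintype.piFinset S ×ˢ S g := by
            intro k hk
            rw [Finset.mem_product, Fintype.mem_piFinset] at hk ⊢
            refine ⟨fun h => ?_, hk.1 g⟩
            rcases eq_or_ne h g with rfl | hne
            · simpa using hk.2
            · simpa [hne] using hk.1 h
          refine Finset.sum_nbij' (fun k => (Function.update k.1 g k.2, k.1 g))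
            (fun k => (Function.update k.1 g k.2, k.1 g)) hmem hmem ?_ ?_ ?_ <;> simp
      _ = _ := by
          rw [Finset.sum_product]
          simp [Finset.mul_sum]
  rw [← Finset.mul_sum, h, ENNReal.inv_mul_cancel_left (by simpa using hg.ne_empty) (by simp)]

lemma uniformMixture_prod {ι O O' : Type*} [MeasurableSpace O] [MeasurableSpace O']
    (t : Finset ι) (K : ι → Measure O) (μ : Measure O') [SFinite μ] :
    uniformMixture t (fun i => (K i).prod μ) = (uniformMixture t K).prod μ := by
  refine Measure.ext_of_lintegral _ fun f hf => ?_
  rw [lintegral_prod _ hf.aemeasurable, lintegral_uniformMixture, lintegral_uniformMixture]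
  simp_rw [lintegral_prod _ hf.aemeasurable]

lemma measurable_update_pair {ι : Type*} [DecidableEq ι] {β : ι → Type*}
    [∀ h, MeasurableSpace (β h)] (g : ι) :
    Measurable fun y : β g × ((h : ι) → β h) => Function.update y.2 g y.1 := by
  refine measurable_pi_lambda _ fun h => ?_
  rcases eq_or_ne h g with rfl | hne
  · simpa using measurable_fst
  · simp only [Function.update_of_ne hne]; fun_prop

lemma pi_update_eq_map {ι : Type*} [Fintype ι] [DecidableEq ι] {β : ι → Type*}
    [∀ h, MeasurableSpace (β h)] (ν : (h : ι) → Measure (β h))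
    [∀ h, IsProbabilityMeasure (ν h)] (g : ι) (ρ : Measure (β g)) [IsProbabilityMeasure ρ] :
    Measure.pi (Function.update ν g ρ) =
      (ρ.prod (Measure.pi ν)).map fun y => Function.update y.2 g y.1 := by
  have hinst : ∀ h, IsProbabilityMeasure (Function.update ν g ρ h) := fun h => by
    rcases eq_or_ne h g with rfl | hne
    · simpa
    · simp only [Function.update_of_ne hne]; infer_instance
  refine (Measure.pi_eq fun s hs => ?_)
  rw [Measure.map_apply (measurable_update_pair g) (MeasurableSet.univ_pi hs)]
  have hpre : (fun y : β g × ((h : ι) → β h) => Function.update y.2 g y.1) ⁻¹'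
      (Set.univ.pi s) = s g ×ˢ Set.univ.pi (Function.update s g Set.univ) := by
    ext y
    simp only [Set.mem_preimage, Set.mem_univ_pi, Set.mem_prod]
    constructor
    · refine fun h => ⟨by simpa using h g, fun h' => ?_⟩
      rcases eq_or_ne h' g with rfl | hne
      · simp
      · simpa [hne] using h h'
    · rintro ⟨h1, h2⟩ h'
      rcases eq_or_ne h' g with rfl | hne
      · simpa using h1
      · simpa [hne] using h2 h'
  rw [hpre, Measure.prod_prod, Measure.pi_pi, ← Finset.mul_prod_erase _ _ (Finset.mem_univ g),
    ← Finset.mul_prod_erase Finset.univ (fun h => Function.update ν g ρ h (s h))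
      (Finset.mem_univ g)]
  simp only [Function.update_self, measure_univ, one_mul]
  congr 1
  refine Finset.prod_congr rfl fun h hh => ?_
  have hne := Finset.ne_of_mem_erase hh
  simp [hne]

variable {Z : Type*} {G d : ℕ} (p : Params Z G d)

lemma Params.groupBatches_nonempty (m : Fin G → ℕ) : (p.groupBatches m).Nonempty := by
  unfold Params.groupBatches
  exact Fintype.piFinset_nonempty.2 fun g => batches_nonempty _ _

/-- With the other batches fixed, the update is an affine image of the subsampled Gaussian on group
g, shifted by a vector r common to both datasets. -/
lemma Params.renyiDom_modelUpdate {α : ℝ} (hα : 1 < α) {eps : ℝ → ℝ → ℝ}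
    (heps : IsPrivacyCurve α eps) (hσ : 0 < p.σ) (hεs : 0 < p.εs) {D D' : p.Dataset}
    (hD : ReplaceOne D D') (θ : EuclideanSpace ℝ (Fin d)) (m : Fin G → ℕ) :
    RenyiDom ((α - 1) / α) (ENNReal.ofReal (Real.exp ((α - 1) / α * p.εs)))
      (p.modelUpdate eps D θ m) (p.modelUpdate eps D' θ m) := by
  obtain ⟨⟨g, i⟩, hi⟩ := hD
  have hα0 : 0 < α := by linarith
  have hs0 : 0 < (α - 1) / α := div_pos (by linarith) hα0
  have hs1 : (α - 1) / α < 1 := by rw [div_lt_one hα0]; linarith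
  have hn : 0 < p.n g := i.pos
  set ξ := p.threshold eps m with hξ
  let c : p.Dataset → (h : Fin G) → Finset (Fin (p.n h)) → EuclideanSpace ℝ (Fin d) :=
    fun D h b => ∑ j ∈ b, clip (gradient (p.loss (D ⟨h, j⟩)) θ) (ξ h)
  have hc : ∀ h ≠ g, c D h = c D' h := fun h hh => by
    ext1 b
    refine Finset.sum_congr rfl fun j _ => ?_
    rw [hi ⟨h, j⟩ fun e => hh (congrArg Sigma.fst e)]
  have hsum : ∀ D B b, ∑ h, c D h (Function.update B g b h) =
      ∑ h ∈ Finset.univ.erase g, c D h (B h) + c D g b := by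
    intro D B b
    rw [← Finset.sum_erase_add _ _ (Finset.mem_univ g), Function.update_self]
    congr 1
    refine Finset.sum_congr rfl fun h hh => ?_
    rw [Function.update_of_ne (Finset.ne_of_mem_erase hh)]
  unfold Params.modelUpdate Params.groupBatches
  rw [uniformMixture_piFinset _ g (batches_nonempty _ _),
    uniformMixture_piFinset _ g (batches_nonempty _ _) (K := fun B => Measure.map _ _)]
  refine RenyiDom.uniformMixture hs0 hs1 (p.groupBatches_nonempty m) fun B _ => ?_
  set r := ∑ h ∈ Finset.univ.erase g, c D h (B h) with hr
  have hr' : r = ∑ h ∈ Finset.univ.erase g, c D' h (B h) :=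
    Finset.sum_congr rfl fun h hh => by rw [hc h (Finset.ne_of_mem_erase hh)]
  have hf : Measurable fun y : EuclideanSpace ℝ (Fin d) => θ - (p.η / p.M) • y := by fun_prop
  have hshift : Measurable fun y : EuclideanSpace ℝ (Fin d) => r + (1 : ℝ) • y := by fun_prop
  have key : ∀ D : p.Dataset, r = ∑ h ∈ Finset.univ.erase g, c D h (B h) →
      (uniformMixture (batches (p.n g) (m g)) fun b =>
        (gaussian (∑ h, c D h (Function.update B g b h)) p.σ).map
          fun y => θ - (p.η / p.M) • y) =
      ((uniformMixture (batches (p.n g) (m g)) fun b => gaussian (c D g b) p.σ).map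
        fun y => r + (1 : ℝ) • y).map fun y => θ - (p.η / p.M) • y := by
    intro D hD
    rw [map_uniformMixture _ _ hshift, map_uniformMixture _ _ hf]
    refine uniformMixture_congr fun b _ => ?_
    rw [map_gaussian, hsum, ← hD, one_smul, one_mul]
  have hfinal : RenyiDom ((α - 1) / α) (ENNReal.ofReal (Real.exp ((α - 1) / α * p.εs)))
      (uniformMixture (batches (p.n g) (m g)) fun b => gaussian (c D g b) p.σ)
      (uniformMixture (batches (p.n g) (m g)) fun b => gaussian (c D' g b) p.σ) := by
    -- The value 0 arises when the budget is infeasible or when arbitrarily small multipliers meet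
    -- it. Then σ / 0 = 0 clips everything to zero, and the two laws agree.
    by_cases hκ : noiseMultiplier eps ((m g : ℝ) / p.n g) p.εs = 0
    · have hξ0 : ξ g = 0 := by rw [hξ, Params.threshold, hκ, div_zero]
      have hc0 : ∀ D b, c D g b = 0 := fun D b =>
        Finset.sum_eq_zero fun j _ => by simp [hξ0, clip]
      simp_rw [hc0]
      have : IsProbabilityMeasure (uniformMixture (batches (p.n g) (m g)) fun _ =>
          gaussian (0 : EuclideanSpace ℝ (Fin d)) p.σ) :=
        isProbabilityMeasure_uniformMixture (batches_nonempty _ _) fun _ _ => inferInstance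
      refine (RenyiDom.refl hs0 hs1 _).mono ?_
      rw [ENNReal.one_le_ofReal]
      exact Real.one_le_exp (by positivity)
    · have h := renyiDom_noiseMultiplier hα heps (d := d) (n := p.n g)
        (γ := (m g : ℝ) / p.n g) (by positivity) hσ hκ
        (x := fun j => gradient (p.loss (D ⟨g, j⟩)) θ)
        (x' := fun j => gradient (p.loss (D' ⟨g, j⟩)) θ)
        ⟨i, fun j hj => by
          dsimp only
          rw [hi ⟨g, j⟩ fun e => hj (eq_of_heq (Sigma.mk.inj e).2)]⟩
      -- The rate m_g / n_g returns exactly m_g after the floor since n_g > 0. It may exceed 1,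
      -- which is why a privacy curve is required for all γ ≥ 0.
      unfold subsampledGaussian at h
      rwa [div_mul_cancel₀ _ (by positivity : (p.n g : ℝ) ≠ 0), Nat.floor_natCast] at h
  have := (hfinal.map hshift).map hf
  rw [← key D hr, ← key D' hr'] at this
  exact this

lemma map_gaussian_linearIsometryEquiv {E F : Type*} [NormedAddCommGroup E]
    [InnerProductSpace ℝ E] [FiniteDimensional ℝ E] [MeasurableSpace E] [BorelSpace E]
    [NormedAddCommGroup F] [InnerProductSpace ℝ F] [FiniteDimensional ℝ F] [MeasurableSpace F]
    [BorelSpace F] (e : E ≃ₗᵢ[ℝ] F) (c : E) (s : ℝ) :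
    (gaussian c s).map e = gaussian (e c) s := by
  have he : Measurable e := e.continuous.measurable
  unfold gaussian
  rw [← stdGaussian_map e, Measure.map_map he (by fun_prop), Measure.map_map (by fun_prop) he]
  congr 1
  ext y
  simp

lemma clip_linearIsometryEquiv {E F : Type*} [NormedAddCommGroup E]
    [NormedSpace ℝ E] [NormedAddCommGroup F] [NormedSpace ℝ F] (e : E ≃ₗᵢ[ℝ] F) (x : E) (ξ : ℝ) :
    e (clip x ξ) = clip (e x) ξ := by
  simp [clip]

lemma renyiDom_subsampled_gaussian_real {α : ℝ} {eps : ℝ → ℝ → ℝ}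
    (heps : IsPrivacyCurve α eps) {n : ℕ} {γ ξ σ : ℝ} (hγ : 0 ≤ γ) (hξ : 0 < ξ) (hσ : 0 < σ)
    {x x' : Fin n → ℝ} (hx : ReplaceOne x x') :
    RenyiDom ((α - 1) / α) (ENNReal.ofReal (Real.exp ((α - 1) / α * eps γ (σ / ξ))))
      (uniformMixture (batches n ⌊γ * n⌋₊) fun b => gaussian (∑ j ∈ b, clip (x j) ξ) σ)
      (uniformMixture (batches n ⌊γ * n⌋₊) fun b => gaussian (∑ j ∈ b, clip (x' j) ξ) σ) := by
  let e : ℝ ≃ₗᵢ[ℝ] EuclideanSpace ℝ (Fin 1) := (OrthonormalBasis.singleton (Fin 1) ℝ).repr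
  obtain ⟨i, hi⟩ := hx
  have h := (heps 1 n γ ξ σ hγ hξ hσ (fun j => e (x j)) (fun j => e (x' j))
    ⟨i, fun j hj => by dsimp only; rw [hi j hj]⟩).map e.symm.continuous.measurable
  have key : ∀ x : Fin n → ℝ, (subsampledGaussian 1 n γ ξ σ fun j => e (x j)).map e.symm =
      uniformMixture (batches n ⌊γ * n⌋₊) fun b => gaussian (∑ j ∈ b, clip (x j) ξ) σ := by
    intro x
    rw [subsampledGaussian, map_uniformMixture _ _ e.symm.continuous.measurable]
    refine uniformMixture_congr fun b _ => ?_
    rw [map_gaussian_linearIsometryEquiv, map_sum]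
    simp_rw [← clip_linearIsometryEquiv, LinearIsometryEquiv.symm_apply_apply]
  rwa [key, key] at h

/-- Given the other batches, the coordinates other than L_g are independent of L_g and have the same
law for both datasets, so they form a product factor with constant 1. -/
lemma Params.renyiDom_lossRelease {α : ℝ} (hα : 1 < α) {eps : ℝ → ℝ → ℝ}
    (heps : IsPrivacyCurve α eps) (hτ : 0 < p.τ) (hζ : 0 < p.ζ) (hγ : 0 ≤ p.γl) {D D' : p.Dataset}
    (hD : ReplaceOne D D') (θ : EuclideanSpace ℝ (Fin d)) :
    RenyiDom ((α - 1) / α) (ENNReal.ofReal (Real.exp ((α - 1) / α * eps p.γl (p.τ / p.ζ))))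
      (p.lossRelease D θ) (p.lossRelease D' θ) := by
  obtain ⟨⟨g, i⟩, hi⟩ := hD
  have hα0 : 0 < α := by linarith
  have hs0 : 0 < (α - 1) / α := div_pos (by linarith) hα0
  have hs1 : (α - 1) / α < 1 := by rw [div_lt_one hα0]; linarith
  let c : p.Dataset → (h : Fin G) → Finset (Fin (p.n h)) → ℝ :=
    fun D h b => ∑ j ∈ b, clip (p.loss (D ⟨h, j⟩) θ) p.ζ
  let ν : p.Dataset → (h : Fin G) → Finset (Fin (p.n h)) → Measure ℝ :=
    fun D h b => (gaussian (c D h b) p.τ).map fun y => 1 / (b.card : ℝ) * y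
  have hνp : ∀ D h b, IsProbabilityMeasure (ν D h b) := fun D h b =>
    Measure.isProbabilityMeasure_map (Measurable.aemeasurable (by fun_prop))
  have hν : ∀ h ≠ g, ν D h = ν D' h := fun h hh => by
    ext1 b
    have : c D h b = c D' h b := Finset.sum_congr rfl fun j _ => by
      rw [hi ⟨h, j⟩ fun e => hh (congrArg Sigma.fst e)]
    simp only [ν, this]
  unfold Params.lossRelease Params.groupBatches
  rw [uniformMixture_piFinset _ g (batches_nonempty _ _),
    uniformMixture_piFinset _ g (batches_nonempty _ _) (K := fun B => Measure.pi _)]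
  refine RenyiDom.uniformMixture hs0 hs1
    (p.groupBatches_nonempty fun h => ⌊p.γl * p.n h⌋₊) fun B _ => ?_
  -- Every batch has the same size N, so the averaging is a fixed scaling, hence post-processing.
  set N := min ⌊p.γl * p.n g⌋₊ (p.n g) with hN
  have hscale : Measurable fun y : ℝ => 1 / (N : ℝ) * y := by fun_prop
  have hupd := measurable_update_pair (β := fun _ : Fin G => ℝ) g
  have key : ∀ D₀ : p.Dataset, (∀ h ≠ g, ν D₀ h = ν D h) →
      (uniformMixture (batches (p.n g) ⌊p.γl * p.n g⌋₊) fun b =>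
        Measure.pi fun h => ν D₀ h (Function.update B g b h)) =
      ((((uniformMixture (batches (p.n g) ⌊p.γl * p.n g⌋₊) fun b =>
        gaussian (c D₀ g b) p.τ).map fun y => 1 / (N : ℝ) * y).prod
          (Measure.pi fun h => ν D h (B h))).map fun y => Function.update y.2 g y.1) := by
    intro D₀ hD₀
    rw [map_uniformMixture _ _ hscale, ← uniformMixture_prod, map_uniformMixture _ _ hupd]
    refine uniformMixture_congr fun b hb => ?_
    have hcard : b.card = N := (Finset.mem_powersetCard.1 hb).2
    have h1 : (gaussian (c D₀ g b) p.τ).map (fun y => 1 / (N : ℝ) * y) = ν D₀ g b := by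
      simp only [ν, hcard]
    have := hνp D₀ g b
    rw [h1, ← pi_update_eq_map (fun h => ν D h (B h)) g (ν D₀ g b)]
    congr 1
    ext1 h
    rcases eq_or_ne h g with rfl | hne
    · simp
    · simp [hne, hD₀ h hne]
  have hprob : IsProbabilityMeasure (Measure.pi fun h => ν D h (B h)) := inferInstance
  have hloss := ((renyiDom_subsampled_gaussian_real heps (n := p.n g) hγ hζ hτ
    (x := fun j => p.loss (D ⟨g, j⟩) θ) (x' := fun j => p.loss (D' ⟨g, j⟩) θ)
    ⟨i, fun j hj => by
      dsimp only
      rw [hi ⟨g, j⟩ fun e => hj (eq_of_heq (Sigma.mk.inj e).2)]⟩).map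
      hscale).prod (RenyiDom.refl hs0 hs1 (Measure.pi fun h => ν D h (B h)))
  have := hloss.map hupd
  rw [mul_one] at this
  refine Eq.mp ?_ this
  congr 1
  · exact (key D fun _ _ => rfl).symm
  · exact (key D' fun h hh => (hν h hh).symm).symm

end Updates

/-! ### Measurability and composition over the iterations -/

section Run

lemma isProbabilityMeasure_addUnits {G : ℕ} (hG : 0 < G) (j : ℕ) (r : Fin G → ℕ) :
    IsProbabilityMeasure (addUnits j r) := by
  induction j generalizing r with
  | zero => exact Measure.dirac.isProbabilityMeasure
  | succ j ih =>
    exact isProbabilityMeasure_uniformMixture ⟨⟨0, hG⟩, Finset.mem_univ _⟩ fun g _ => ih _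

lemma isProbabilityMeasure_removeUnits {G : ℕ} (j : ℕ) (r : Fin G → ℕ) (hj : j ≤ ∑ g, r g) :
    IsProbabilityMeasure (removeUnits j r) := by
  induction j generalizing r with
  | zero => exact Measure.dirac.isProbabilityMeasure
  | succ j ih =>
    refine isProbabilityMeasure_uniformMixture ?_ fun g hg => ih _ ?_
    · by_contra h
      rw [Finset.not_nonempty_iff_eq_empty, Finset.filter_eq_empty_iff] at h
      rw [Finset.sum_eq_zero fun g hg => not_not.1 (h hg)] at hj
      omega
    · have hg' : r g ≠ 0 := (Finset.mem_filter.1 hg).2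
      rw [Finset.sum_update_of_mem (Finset.mem_univ g)]
      rw [← Finset.add_sum_erase _ _ (Finset.mem_univ g), Finset.erase_eq] at hj
      omega

lemma isProbabilityMeasure_roundTo {G : ℕ} (hG : 0 < G) (M : ℕ) (x : Fin G → ℝ) :
    IsProbabilityMeasure (roundTo M x) := by
  unfold roundTo
  dsimp only
  split_ifs
  · exact isProbabilityMeasure_addUnits hG _ _
  · exact isProbabilityMeasure_removeUnits _ _ (Nat.sub_le _ _)

lemma measurable_bankersRound : Measurable bankersRound := by
  have hfl : Measurable fun x : ℝ => (⌊x⌋₊ : ℝ) :=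
    (measurable_from_nat (f := fun n : ℕ => (n : ℝ))).comp Nat.measurable_floor
  have heven : MeasurableSet {x : ℝ | Even ⌊x⌋₊} :=
    Nat.measurable_floor (MeasurableSet.of_discrete (s := {n : ℕ | Even n}))
  unfold bankersRound
  refine Measurable.ite (measurableSet_lt (by fun_prop) (by fun_prop)) Nat.measurable_floor ?_
  refine Measurable.ite (measurableSet_lt (by fun_prop) (by fun_prop))
    (Nat.measurable_floor.add_const 1) ?_
  exact Measurable.ite heven Nat.measurable_floor (Nat.measurable_floor.add_const 1)

lemma measurable_roundTo {G : ℕ} (M : ℕ) : Measurable (roundTo (G := G) M) := by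
  have h : Measurable fun r : Fin G → ℕ =>
      if ∑ g, r g ≤ M then addUnits (M - ∑ g, r g) r else removeUnits (∑ g, r g - M) r :=
    Measurable.of_discrete
  have hr : Measurable fun (x : Fin G → ℝ) g => bankersRound (x g) :=
    measurable_pi_lambda _ fun g => measurable_bankersRound.comp (measurable_pi_apply g)
  exact h.comp hr

lemma measurable_gradient {E : Type*} [NormedAddCommGroup E] [InnerProductSpace ℝ E]
    [FiniteDimensional ℝ E] [MeasurableSpace E] [BorelSpace E] (f : E → ℝ) :
    Measurable (gradient f) := by
  borelize (StrongDual ℝ E)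
  exact (InnerProductSpace.toDual ℝ E).symm.continuous.measurable.comp (measurable_fderiv ℝ f)

lemma measurable_clip {X E : Type*} [MeasurableSpace X] [NormedAddCommGroup E] [NormedSpace ℝ E]
    [SecondCountableTopology E] [MeasurableSpace E] [BorelSpace E] {f : X → E} (hf : Measurable f)
    (ξ : ℝ) : Measurable fun x => clip (f x) ξ := by
  unfold clip
  fun_prop

variable {Z : Type*} {G d : ℕ} (p : Params Z G d)

/-- The batch sizes are countable and can be fixed; each mixture component is then the image of one
standard Gaussian under a map jointly measurable in θ and the noise. -/
lemma Params.measurable_modelUpdate (eps : ℝ → ℝ → ℝ) (D : p.Dataset) :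
    Measurable fun s : EuclideanSpace ℝ (Fin d) × (Fin G → ℕ) =>
      p.modelUpdate eps D s.1 s.2 := by
  refine measurable_from_prod_countable_left fun m => ?_
  unfold Params.modelUpdate
  dsimp only
  refine measurable_uniformMixture _ fun B => ?_
  have hc : Measurable fun θ => ∑ g, ∑ i ∈ B g,
      clip (gradient (p.loss (D ⟨g, i⟩)) θ) (p.threshold eps m g) :=
    Finset.measurable_fun_sum _ fun g _ => Finset.measurable_fun_sum _ fun i _ =>
      measurable_clip (measurable_gradient _) _
  have h : ∀ θ c : EuclideanSpace ℝ (Fin d),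
      (gaussian c p.σ).map (fun y => θ - (p.η / p.M) • y) =
        (stdGaussian _).map fun y => θ - (p.η / p.M) • (c + p.σ • y) := fun θ c => by
    rw [gaussian, Measure.map_map (by fun_prop) (by fun_prop)]
    rfl
  simp_rw [h]
  refine measurable_map_prodMk _ ?_
  exact measurable_fst.sub
    (((hc.comp measurable_fst).add (measurable_snd.const_smul p.σ)).const_smul (p.η / p.M))

lemma Params.isProbabilityMeasure_modelUpdate (eps : ℝ → ℝ → ℝ) (D : p.Dataset)
    (θ : EuclideanSpace ℝ (Fin d)) (m : Fin G → ℕ) :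
    IsProbabilityMeasure (p.modelUpdate eps D θ m) :=
  isProbabilityMeasure_uniformMixture (p.groupBatches_nonempty m) fun _ _ =>
    Measure.isProbabilityMeasure_map (Measurable.aemeasurable (by fun_prop))

lemma Params.measurable_lossRelease (hloss : ∀ z, Measurable (p.loss z)) (D : p.Dataset) :
    Measurable (p.lossRelease D) := by
  refine measurable_uniformMixture _ fun B => ?_
  have h : ∀ θ, (Measure.pi fun g =>
      (gaussian (∑ i ∈ B g, clip (p.loss (D ⟨g, i⟩) θ) p.ζ) p.τ).map
        fun y => 1 / ((B g).card : ℝ) * y) =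
      (Measure.pi fun _ : Fin G => stdGaussian ℝ).map fun y g => 1 / ((B g).card : ℝ) *
        (∑ i ∈ B g, clip (p.loss (D ⟨g, i⟩) θ) p.ζ + p.τ • y g) := by
    intro θ
    have hm : ∀ g, Measurable fun y : ℝ => 1 / ((B g).card : ℝ) *
        (∑ i ∈ B g, clip (p.loss (D ⟨g, i⟩) θ) p.ζ + p.τ • y) := fun g => by fun_prop
    have : ∀ g, SigmaFinite ((stdGaussian ℝ).map fun y : ℝ => 1 / ((B g).card : ℝ) *
        (∑ i ∈ B g, clip (p.loss (D ⟨g, i⟩) θ) p.ζ + p.τ • y)) := fun g => inferInstance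
    rw [Measure.pi_map_pi fun g => (hm g).aemeasurable]
    congr 1
    ext1 g
    rw [gaussian, Measure.map_map (by fun_prop) (by fun_prop)]
    rfl
  simp_rw [h]
  refine measurable_map_prodMk _ (measurable_pi_lambda _ fun g => ?_)
  have hc : Measurable fun θ => ∑ i ∈ B g, clip (p.loss (D ⟨g, i⟩) θ) p.ζ :=
    Finset.measurable_fun_sum _ fun i _ => measurable_clip (hloss _) _
  exact ((hc.comp measurable_fst).add
    (((measurable_pi_apply g).comp measurable_snd).const_smul p.τ)).const_mul _

lemma Params.isProbabilityMeasure_lossRelease (D : p.Dataset) (θ : EuclideanSpace ℝ (Fin d)) :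
    IsProbabilityMeasure (p.lossRelease D θ) := by
  refine isProbabilityMeasure_uniformMixture (p.groupBatches_nonempty _) fun B _ => ?_
  have : ∀ g, IsProbabilityMeasure
      ((gaussian (∑ i ∈ B g, clip (p.loss (D ⟨g, i⟩) θ) p.ζ) p.τ).map
        fun y => 1 / ((B g).card : ℝ) * y) := fun g =>
    Measure.isProbabilityMeasure_map (Measurable.aemeasurable (by fun_prop))
  infer_instance

lemma isProbabilityMeasure_bind {X O : Type*} [MeasurableSpace X] [MeasurableSpace O]
    {P : Measure X} [IsProbabilityMeasure P] {K : X → Measure O} (hK : Measurable K)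
    (hKp : ∀ x, IsProbabilityMeasure (K x)) : IsProbabilityMeasure (P.bind K) := by
  constructor
  rw [Measure.bind_apply MeasurableSet.univ hK.aemeasurable]
  simp

lemma Params.measurable_round (m : Fin G → ℕ) : Measurable fun L : Fin G → ℝ =>
    roundTo p.M fun g =>
      p.M * (m g * Real.exp (p.ηl * L g)) / ∑ h, |m h * Real.exp (p.ηl * L h)| := by
  refine (measurable_roundTo p.M).comp (measurable_pi_lambda _ fun g => ?_)
  fun_prop

lemma Params.measurable_batchSizeUpdate (hloss : ∀ z, Measurable (p.loss z)) (D : p.Dataset) :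
    Measurable fun s : EuclideanSpace ℝ (Fin d) × (Fin G → ℕ) =>
      p.batchSizeUpdate D s.1 s.2 :=
  measurable_from_prod_countable_left fun m =>
    (Measure.measurable_bind' (p.measurable_round m)).comp (p.measurable_lossRelease hloss D)

lemma Params.isProbabilityMeasure_batchSizeUpdate (hG : 0 < G) (D : p.Dataset)
    (θ : EuclideanSpace ℝ (Fin d)) (m : Fin G → ℕ) :
    IsProbabilityMeasure (p.batchSizeUpdate D θ m) := by
  have := p.isProbabilityMeasure_lossRelease D θ
  exact isProbabilityMeasure_bind (p.measurable_round m) fun L => isProbabilityMeasure_roundTo hG _ _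

lemma Params.isProbabilityMeasure_batchSizes (hG : 0 < G) (D : p.Dataset) (t : ℕ)
    (s : EuclideanSpace ℝ (Fin d) × (Fin G → ℕ)) :
    IsProbabilityMeasure
      (if t % p.k = 0 then p.batchSizeUpdate D s.1 s.2 else Measure.dirac s.2) := by
  split_ifs
  · exact p.isProbabilityMeasure_batchSizeUpdate hG D s.1 s.2
  · infer_instance

lemma Params.isProbabilityMeasure_step (hG : 0 < G) (eps : ℝ → ℝ → ℝ) (D : p.Dataset) (t : ℕ)
    (s : EuclideanSpace ℝ (Fin d) × (Fin G → ℕ)) : IsProbabilityMeasure (p.step eps D t s) := by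
  have := p.isProbabilityMeasure_modelUpdate eps D s.1 s.2
  have := p.isProbabilityMeasure_batchSizes hG D t s
  unfold Params.step
  infer_instance

lemma Params.measurable_step (hG : 0 < G) (hloss : ∀ z, Measurable (p.loss z))
    (eps : ℝ → ℝ → ℝ) (D : p.Dataset) (t : ℕ) : Measurable (p.step eps D t) := by
  have h2 : Measurable fun s : EuclideanSpace ℝ (Fin d) × (Fin G → ℕ) =>
      if t % p.k = 0 then p.batchSizeUpdate D s.1 s.2 else Measure.dirac s.2 := by
    split_ifs
    · exact p.measurable_batchSizeUpdate hloss D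
    · exact Measure.measurable_dirac.comp measurable_snd
  let κ₁ : Kernel (EuclideanSpace ℝ (Fin d) × (Fin G → ℕ)) (EuclideanSpace ℝ (Fin d)) :=
    ⟨_, p.measurable_modelUpdate eps D⟩
  let κ₂ : Kernel (EuclideanSpace ℝ (Fin d) × (Fin G → ℕ)) (Fin G → ℕ) := ⟨_, h2⟩
  have : IsMarkovKernel κ₁ := ⟨fun s => p.isProbabilityMeasure_modelUpdate eps D s.1 s.2⟩
  have : IsMarkovKernel κ₂ := ⟨fun s => p.isProbabilityMeasure_batchSizes hG D t s⟩
  convert (κ₁ ×ₖ κ₂).measurable using 1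
  ext1 s
  rw [Kernel.prod_apply]
  rfl

lemma Params.isProbabilityMeasure_run (hG : 0 < G) (hloss : ∀ z, Measurable (p.loss z))
    [IsProbabilityMeasure p.θinit] (eps : ℝ → ℝ → ℝ) (D : p.Dataset) (t : ℕ) :
    IsProbabilityMeasure (p.run eps D t) := by
  induction t with
  | zero =>
    have := isProbabilityMeasure_roundTo hG p.M fun _ => (p.M : ℝ) / G
    unfold Params.run
    infer_instance
  | succ t ih =>
    exact isProbabilityMeasure_bind (p.measurable_step hG hloss eps D (t + 1))
      fun s => p.isProbabilityMeasure_step hG eps D (t + 1) s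

lemma Params.renyiDom_step (hG : 0 < G) {α : ℝ} (hα : 1 < α) {eps : ℝ → ℝ → ℝ}
    (heps : IsPrivacyCurve α eps) (hσ : 0 < p.σ) (hτ : 0 < p.τ) (hζ : 0 < p.ζ) (hεs : 0 < p.εs)
    (hγ : 0 ≤ p.γl) {D D' : p.Dataset} (hD : ReplaceOne D D') (t : ℕ)
    (s : EuclideanSpace ℝ (Fin d) × (Fin G → ℕ)) :
    RenyiDom ((α - 1) / α) (ENNReal.ofReal (Real.exp ((α - 1) / α *
        (p.εs + if t % p.k = 0 then eps p.γl (p.τ / p.ζ) else 0))))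
      (p.step eps D t s) (p.step eps D' t s) := by
  have hs0 : 0 < (α - 1) / α := div_pos (by linarith) (by linarith)
  have hs1 : (α - 1) / α < 1 := by rw [div_lt_one (by linarith)]; linarith
  have := p.isProbabilityMeasure_batchSizes hG D t s
  have := p.isProbabilityMeasure_batchSizes hG D' t s
  rw [mul_add, Real.exp_add, ENNReal.ofReal_mul (Real.exp_pos _).le]
  refine (p.renyiDom_modelUpdate hα heps hσ hεs hD s.1 s.2).prod ?_
  split_ifs
  -- Rounding is the same random kernel for both datasets, hence contributes the constant 1.
  · have h := (p.renyiDom_lossRelease hα heps hτ hζ hγ hD s.1).bind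
      (p.measurable_round s.2) (p.measurable_round s.2) fun L => by
        have := isProbabilityMeasure_roundTo hG p.M fun g =>
          p.M * (s.2 g * Real.exp (p.ηl * L g)) / ∑ h, |s.2 h * Real.exp (p.ηl * L h)|
        exact RenyiDom.refl hs0 hs1 _
    rwa [mul_one] at h
  · simpa using RenyiDom.refl hs0 hs1 (Measure.dirac s.2)

lemma Params.renyiDom_run (hG : 0 < G) {α : ℝ} (hα : 1 < α) {eps : ℝ → ℝ → ℝ}
    (heps : IsPrivacyCurve α eps) (hσ : 0 < p.σ) (hτ : 0 < p.τ) (hζ : 0 < p.ζ) (hεs : 0 < p.εs)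
    (hγ : 0 ≤ p.γl) (hloss : ∀ z, Measurable (p.loss z)) [IsProbabilityMeasure p.θinit]
    {D D' : p.Dataset} (hD : ReplaceOne D D') (t : ℕ) :
    RenyiDom ((α - 1) / α) (ENNReal.ofReal (Real.exp ((α - 1) / α *
        (t * p.εs + ((t / p.k : ℕ) : ℝ) * eps p.γl (p.τ / p.ζ)))))
      (p.run eps D t) (p.run eps D' t) := by
  have hs0 : 0 < (α - 1) / α := div_pos (by linarith) (by linarith)
  have hs1 : (α - 1) / α < 1 := by rw [div_lt_one (by linarith)]; linarith
  induction t with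
  | zero =>
    have := p.isProbabilityMeasure_run hG hloss eps D 0
    have h : p.run eps D' 0 = p.run eps D 0 := rfl
    simpa [h] using RenyiDom.refl hs0 hs1 (p.run eps D 0)
  | succ t ih =>
    have h := ih.bind (p.measurable_step hG hloss eps D (t + 1))
      (p.measurable_step hG hloss eps D' (t + 1))
      (p.renyiDom_step hG hα heps hσ hτ hζ hεs hγ hD (t + 1))
    rw [← ENNReal.ofReal_mul (Real.exp_pos _).le, ← Real.exp_add, ← mul_add] at h
    refine h.mono (le_of_eq ?_)
    congr 3
    -- The quotient by k increases exactly when k divides t + 1, that is, in the iterations that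
    -- release losses.
    rw [Nat.succ_div]
    simp only [Nat.dvd_iff_mod_eq_zero]
    split_ifs <;> push_cast <;> ring

lemma Params.isRDP_asc (hG : 0 < G) {α : ℝ} (hα : 1 < α) {eps : ℝ → ℝ → ℝ}
    (heps : IsPrivacyCurve α eps) (hσ : 0 < p.σ) (hτ : 0 < p.τ) (hζ : 0 < p.ζ) (hεs : 0 < p.εs)
    (hγ : 0 ≤ p.γl) (hloss : ∀ z, Measurable (p.loss z)) [IsProbabilityMeasure p.θinit] :
    IsRDP α (p.T * p.εs + ((p.T / p.k : ℕ) : ℝ) * eps p.γl (p.τ / p.ζ)) (p.asc eps) := by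
  have hprob : ∀ D, IsProbabilityMeasure (p.asc eps D) := fun D => by
    have := p.isProbabilityMeasure_run hG hloss eps D p.T
    exact Measure.isProbabilityMeasure_map measurable_fst.aemeasurable
  refine ⟨hprob, fun D D' hD => ?_⟩
  have := hprob D
  have := hprob D'
  exact renyiDiv_le_of_renyiDom hα
    ((p.renyiDom_run hG hα heps hσ hτ hζ hεs hγ hloss hD p.T).map measurable_fst)

end Run

end ASC

/-- The ASC algorithm is `(α, ε)`-RDP with `ε = T ε^s + ⌊T/k⌋ ε_α(γ^ℓ, τ/ζ)`, both for the exact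
privacy curve of the subsampled Gaussian mechanism (any real `α > 1`) and for its closed form
(any integer `α ≥ 2`). -/
theorem theorem1 {Z : Type*} {G d : ℕ} (hG : 0 < G) (p : ASC.Params Z G d)
    (hk : 0 < p.k) (hσ : 0 < p.σ) (hτ : 0 < p.τ) (hζ : 0 < p.ζ) (hεs : 0 < p.εs)
    (hγ0 : 0 ≤ p.γl) (hγ1 : p.γl ≤ 1)
    (hloss : ∀ z, Measurable (p.loss z))
    (hinit : IsProbabilityMeasure p.θinit) :
    (∀ α : ℝ, 1 < α →
      ASC.IsRDP α
        (p.T * p.εs + ((p.T / p.k : ℕ) : ℝ) * ASC.epsSG α p.γl (p.τ / p.ζ))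
        (p.asc (ASC.epsSG α))) ∧
    (∀ a : ℕ, 2 ≤ a →
      ASC.IsRDP (a : ℝ)
        (p.T * p.εs + ((p.T / p.k : ℕ) : ℝ) * ASC.epsClosed a p.γl (p.τ / p.ζ))
        (p.asc (ASC.epsClosed a))) := by

  refine ⟨fun α hα => ?_, fun a ha => ?_⟩
  · exact p.isRDP_asc hG hα (ASC.isPrivacyCurve_epsSG hα) hσ hτ hζ hεs hγ0 hloss
  · exact p.isRDP_asc hG (by exact_mod_cast ha) (ASC.isPrivacyCurve_epsClosed ha) hσ hτ hζ hεs hγ0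
      hloss
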